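/- Let $\omega:\mathbb{Z}\to[\frac12,1)$ be a deterministic environment, and let $\{X_n\}_{n\ge 0}$ be the random walk on $\mathbb{Z}$ in the "have your cookie and eat it" environment $\omega$: with $\mathcal F_n=\sigma(X_0,\dots,X_n)$, $$P(X_{n+1}=X_n+1\mid\mathcal F_n)=1-P(X_{n+1}=X_n-1\mid\mathcal F_n)=\begin{cases}\frac12,&\text{if the walk has jumped to the left from the site } X_n \text{ at some time } m<n,\\ \omega(X_n),&\text{otherwise.}\end{cases}$$ Let $P_y$ denote the probability for the walk started at $X_0=y$, and let $T_x=\inf\{n\ge0:X_n=x\}$. The walk is called recurrent (respectively transient) if $P_y(X_n=x\text{ for infinitely many }n)$ equals $1$ (respectively $0$) for all $x,y\in\mathbb{Z}$. (i) Let $\omega(x)=p$ for all $x\in\mathbb{Z}$, where $p\in(\frac12,1)$. If $p\le\frac23$, then $P_1(T_0=\infty)=0$. If $p\in(\frac23,1)$, then $$\frac{3p-2}{p}\le P_1(T_0=\infty)\le\frac{3p-2}{p(2p-1)}.$$ Moreover the walk is recurrent if and only if $p\le\frac23$, and transient if and only if $p>\frac23$. (ii) Let $\omega$ be periodic with period $N\ge1$,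 that is, $\omega(x+N)=\omega(x)$ for all $x\in\mathbb{Z}$. Then the walk is recurrent if and only if $\frac1N\sum_{x=1}^N\frac{\omega(x)}{1-\omega(x)}\le2$, and transient if and only if $\frac1N\sum_{x=1}^N\frac{\omega(x)}{1-\omega(x)}>2$. -/

import Mathlib

open MeasureTheory ProbabilityTheory Filter

namespace CookieWalk

open Classical in
/-- The probability of jumping to the right at time `n`, for a walker whose path up to time `n`
is `h 0, …, h n`: it is `ω (h n)` as long as the path has not yet jumped to the left from the
current site `h n`, and `1 / 2` from the first such left jump onward. -/
noncomputable def rightProb (ω : ℤ → ℝ) (h : ℕ → ℤ) (n : ℕ) : ℝ :=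
  if ∃ m : ℕ, m < n ∧ h m = h n ∧ h (m + 1) = h m - 1 then 1 / 2 else ω (h n)

/-- `X`, under the family `P y` (`y ∈ ℤ`) of probability measures, is a random walk in the
"have your cookie and eat it" environment `ω`: under `P y` it starts at `y`, and conditionally on
its natural filtration at time `n` it jumps one step to the right with probability
`rightProb ω X n` and one step to the left with the complementary probability. -/
structure IsCookieWalk {Ω : Type*} [MeasurableSpace Ω] (ω : ℤ → ℝ) (P : ℤ → Measure Ω)
    (X : ℕ → Ω → ℤ) : Prop where
  isProbabilityMeasure : ∀ y, IsProbabilityMeasure (P y)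
  measurable : ∀ n, Measurable (X n)
  start : ∀ y, ∀ᵐ a ∂(P y), X 0 a = y
  right : ∀ (y : ℤ) (n : ℕ),
    (P y)⟦{a | X (n + 1) a = X n a + 1} |
        Filtration.natural X (fun k => (measurable k).stronglyMeasurable) n⟧
      =ᵐ[P y] fun a => rightProb ω (fun k => X k a) n
  left : ∀ (y : ℤ) (n : ℕ),
    (P y)⟦{a | X (n + 1) a = X n a - 1} |
        Filtration.natural X (fun k => (measurable k).stronglyMeasurable) n⟧
      =ᵐ[P y] fun a => 1 - rightProb ω (fun k => X k a) n

/-- The hitting time `T_x = inf {n ≥ 0 : X_n = x}`, equal to `⊤` if `x` is never hit. -/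
noncomputable def hitTime {Ω : Type*} (X : ℕ → Ω → ℤ) (x : ℤ) : Ω → WithTop ℕ :=
  hittingAfter X {x} 0

/-- Recurrence: `P_y (X_n = x i.o.) = 1` for all `x` and `y`. -/
def Recurrent {Ω : Type*} [MeasurableSpace Ω] (P : ℤ → Measure Ω) (X : ℕ → Ω → ℤ) : Prop :=
  ∀ x y : ℤ, P y {a | ∃ᶠ n in atTop, X n a = x} = 1

/-- Transience: `P_y (X_n = x i.o.) = 0` for all `x` and `y`. -/
def Transient {Ω : Type*} [MeasurableSpace Ω] (P : ℤ → Measure Ω) (X : ℕ → Ω → ℤ) : Prop :=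
  ∀ x y : ℤ, P y {a | ∃ᶠ n in atTop, X n a = x} = 0

end CookieWalk

/-! The position together with the set of sites already left-jumped from is a Markov chain, and all
probabilities are computed analytically as limits of its finite-step hitting probabilities
(`hitLim`); they are identified with events of the walk only near the end.

A site `z` contributes drift `2 * ω z - 1` per visit until its first left jump, which happens with
probability `1 - ω z` at each such visit. So the mean drift collected at `z` before a stopping time
is `siteDrift ω z` times the probability that a left jump from `z` has occurred by then. On exit
from `[x, n)` this probability factors: `z` must be reached before `x - 1`, and at that moment
everything from `z` onward is fresh, so the factor `leftBefore ω z n` follows. Optional stopping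
thus gives an exact identity, `mul_one_sub_leftBefore`.

In an environment of period `N`, write `q z` for `escapeProb ω z`. Averaging the identity over many
periods gives `∑ siteDrift ω z * (1 - q z) ≤ N` over one period, always (`sum_siteDrift_mul_le`),
and the reverse inequality if `q 1 > 0` (`le_sum_siteDrift_mul`, by Cesàro means). Since `siteDrift
= ω / (1 - ω) - 1`, this forces `q = 0` everywhere when the mean of `ω / (1 - ω)` is at most 2 and
`q > 0` everywhere otherwise. In the homogeneous case it even yields `q = (3p - 2) / (2p - 1)`,
which lies between the two claimed bounds.

Every level to the right is reached almost surely. If `q = 0`, so is every level to the left, and a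
nearest-neighbour path unbounded in both directions visits each site infinitely often. If `q > 0`,
then given the past, a far unvisited site is never left-jumped from with probability bounded below;
Lévy's upward theorem turns this into transience. -/

namespace CookieWalk

/-! ### The chain of states and its hitting probabilities -/

open Classical in
/-- The probability of a right jump from `x` when `S` is the set of sites from which a left jump
has already been made. -/
noncomputable def jumpProb (ω : ℤ → ℝ) (x : ℤ) (S : Set ℤ) : ℝ := if x ∈ S then 1 / 2 else ω x

/-- The one-step transition operator of the Markov chain (position, set of left-jumped sites). -/
noncomputable def stepAvg (ω : ℤ → ℝ) (f : ℤ → Set ℤ → ℝ) (x : ℤ) (S : Set ℤ) : ℝ :=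
  jumpProb ω x S * f (x + 1) S + (1 - jumpProb ω x S) * f (x - 1) (insert x S)

open Classical in
/-- The probability that the chain started at `(x, S)` reaches `A` within `m` steps and
before reaching `B`. -/
noncomputable def hitProb (ω : ℤ → ℝ) (A B : Set ℤ) : ℕ → ℤ → Set ℤ → ℝ
  | 0, x, _ => if x ∈ A then 1 else 0
  | m + 1, x, S => if x ∈ A then 1 else if x ∈ B then 0 else stepAvg ω (hitProb ω A B m) x S

/-- The probability that the chain started at `(x, S)` reaches `A` before `B`. -/
noncomputable def hitLim (ω : ℤ → ℝ) (A B : Set ℤ) (x : ℤ) (S : Set ℤ) : ℝ :=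
  ⨆ m, hitProb ω A B m x S

/-- The set of sites from which the path `h` has jumped to the left before time `n`. -/
def leftSites (h : ℕ → ℤ) (n : ℕ) : Set ℤ := {x | ∃ m < n, h m = x ∧ h (m + 1) = h m - 1}

/-- The states reachable from a state without left-jumped sites: to the right of the
position, the left-jumped sites are an initial segment. -/
def Good (x : ℤ) (S : Set ℤ) : Prop := ∀ z u : ℤ, x < z → z ≤ u → u ∈ S → z ∈ S

theorem good_empty (x : ℤ) : Good x ∅ := fun _ _ _ _ h => h.elim

theorem Good.right {x : ℤ} {S : Set ℤ} (h : Good x S) : Good (x + 1) S :=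
  fun z u hz hu hS => h z u (by omega) hu hS

/-- The departure site, now immediately to the right of the walker, becomes marked, so it extends
the initial segment downward. -/
theorem Good.left {x : ℤ} {S : Set ℤ} (h : Good x S) : Good (x - 1) (insert x S) := by
  intro z u hz hu hS
  rcases eq_or_ne z x with rfl | hne
  · exact Set.mem_insert _ _
  · rcases hS with rfl | hS
    · omega
    · exact Set.mem_insert_of_mem _ (h z u (by omega) hu hS)

section

variable {ω : ℤ → ℝ}

theorem half_le_jumpProb (hω : ∀ x, ω x ∈ Set.Ico (1 / 2 : ℝ) 1) (x : ℤ) (S : Set ℤ) :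
    1 / 2 ≤ jumpProb ω x S := by
  unfold jumpProb; split_ifs
  · exact le_rfl
  · exact (hω x).1

theorem jumpProb_le_one (hω : ∀ x, ω x ∈ Set.Ico (1 / 2 : ℝ) 1) (x : ℤ) (S : Set ℤ) :
    jumpProb ω x S ≤ 1 := by
  unfold jumpProb; split_ifs
  · norm_num
  · exact (hω x).2.le

theorem stepAvg_mono (hω : ∀ x, ω x ∈ Set.Ico (1 / 2 : ℝ) 1) {f g : ℤ → Set ℤ → ℝ} {x : ℤ}
    {S : Set ℤ} (h₁ : f (x + 1) S ≤ g (x + 1) S)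
    (h₂ : f (x - 1) (insert x S) ≤ g (x - 1) (insert x S)) :
    stepAvg ω f x S ≤ stepAvg ω g x S :=
  add_le_add
    (mul_le_mul_of_nonneg_left h₁ (by linarith [half_le_jumpProb hω x S]))
    (mul_le_mul_of_nonneg_left h₂ (by linarith [jumpProb_le_one hω x S]))

theorem stepAvg_const (c : ℝ) (x : ℤ) (S : Set ℤ) : stepAvg ω (fun _ _ => c) x S = c := by
  unfold stepAvg; ring

theorem hitProb_mem_Icc (hω : ∀ x, ω x ∈ Set.Ico (1 / 2 : ℝ) 1) (A B : Set ℤ) (m : ℕ) :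
    ∀ x S, hitProb ω A B m x S ∈ Set.Icc (0 : ℝ) 1 := by
  induction m with
  | zero => intro x S; unfold hitProb; split_ifs <;> simp
  | succ m ih =>
    intro x S; unfold hitProb; split_ifs
    · simp
    · simp
    · constructor
      · have := stepAvg_mono hω (f := fun _ _ => 0) (g := hitProb ω A B m) (x := x) (S := S)
          (ih _ _).1 (ih _ _).1
        rwa [stepAvg_const] at this
      · have := stepAvg_mono hω (g := fun _ _ => 1) (f := hitProb ω A B m) (x := x) (S := S)
          (ih _ _).2 (ih _ _).2
        rwa [stepAvg_const] at this

theorem hitProb_le_succ (hω : ∀ x, ω x ∈ Set.Ico (1 / 2 : ℝ) 1) (A B : Set ℤ) (m : ℕ) :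
    ∀ x S, hitProb ω A B m x S ≤ hitProb ω A B (m + 1) x S := by
  induction m with
  | zero =>
    intro x S
    rw [hitProb, hitProb]
    split_ifs
    · exact le_rfl
    · exact le_rfl
    · have := (hitProb_mem_Icc hω A B 1 x S).1
      rw [hitProb] at this
      simpa [*] using this
  | succ m ih =>
    intro x S
    rw [hitProb, hitProb]
    split_ifs
    · exact le_rfl
    · exact le_rfl
    · exact stepAvg_mono hω (ih _ _) (ih _ _)

theorem hitProb_mono (hω : ∀ x, ω x ∈ Set.Ico (1 / 2 : ℝ) 1) (A B : Set ℤ) (x : ℤ) (S : Set ℤ) :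
    Monotone fun m => hitProb ω A B m x S :=
  monotone_nat_of_le_succ fun m => hitProb_le_succ hω A B m x S

theorem bddAbove_hitProb (hω : ∀ x, ω x ∈ Set.Ico (1 / 2 : ℝ) 1) (A B : Set ℤ) (x : ℤ)
    (S : Set ℤ) : BddAbove (Set.range fun m => hitProb ω A B m x S) :=
  ⟨1, by rintro _ ⟨m, rfl⟩; exact (hitProb_mem_Icc hω A B m x S).2⟩

theorem tendsto_hitProb (hω : ∀ x, ω x ∈ Set.Ico (1 / 2 : ℝ) 1) (A B : Set ℤ) (x : ℤ)
    (S : Set ℤ) :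
    Tendsto (fun m => hitProb ω A B m x S) atTop (nhds (hitLim ω A B x S)) :=
  tendsto_atTop_ciSup (hitProb_mono hω A B x S) (bddAbove_hitProb hω A B x S)

theorem hitProb_le_hitLim (hω : ∀ x, ω x ∈ Set.Ico (1 / 2 : ℝ) 1) (A B : Set ℤ) (m : ℕ) (x : ℤ)
    (S : Set ℤ) : hitProb ω A B m x S ≤ hitLim ω A B x S :=
  le_ciSup (bddAbove_hitProb hω A B x S) m

theorem hitLim_nonneg (hω : ∀ x, ω x ∈ Set.Ico (1 / 2 : ℝ) 1) (A B : Set ℤ) (x : ℤ)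
    (S : Set ℤ) : 0 ≤ hitLim ω A B x S :=
  (hitProb_mem_Icc hω A B 0 x S).1.trans (hitProb_le_hitLim hω A B 0 x S)

theorem hitLim_le_one (hω : ∀ x, ω x ∈ Set.Ico (1 / 2 : ℝ) 1) (A B : Set ℤ) (x : ℤ)
    (S : Set ℤ) : hitLim ω A B x S ≤ 1 :=
  ciSup_le fun m => (hitProb_mem_Icc hω A B m x S).2

theorem hitProb_of_mem {A B : Set ℤ} {x : ℤ} (hx : x ∈ A) (m : ℕ) (S : Set ℤ) :
    hitProb ω A B m x S = 1 := by
  cases m <;> simp [hitProb, hx]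

theorem hitProb_of_mem_kill {A B : Set ℤ} {x : ℤ} (hA : x ∉ A) (hB : x ∈ B) (m : ℕ)
    (S : Set ℤ) : hitProb ω A B m x S = 0 := by
  cases m <;> simp [hitProb, hA, hB]

theorem hitLim_of_mem {A B : Set ℤ} {x : ℤ} (hx : x ∈ A) (S : Set ℤ) :
    hitLim ω A B x S = 1 := by
  simp [hitLim, hitProb_of_mem hx]

theorem hitLim_of_mem_kill {A B : Set ℤ} {x : ℤ} (hA : x ∉ A) (hB : x ∈ B) (S : Set ℤ) :
    hitLim ω A B x S = 0 := by
  simp [hitLim, hitProb_of_mem_kill hA hB]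

theorem hitLim_eq_stepAvg (hω : ∀ x, ω x ∈ Set.Ico (1 / 2 : ℝ) 1) {A B : Set ℤ} {x : ℤ}
    (hA : x ∉ A) (hB : x ∉ B) (S : Set ℤ) :
    hitLim ω A B x S = stepAvg ω (hitLim ω A B) x S := by
  have h₁ := (tendsto_hitProb hω A B x S).comp (tendsto_add_atTop_nat 1)
  have h₂ : Tendsto (fun m => stepAvg ω (hitProb ω A B m) x S) atTop
      (nhds (stepAvg ω (hitLim ω A B) x S)) :=
    ((tendsto_hitProb hω A B _ _).const_mul _).add ((tendsto_hitProb hω A B _ _).const_mul _)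
  refine tendsto_nhds_unique h₁ (h₂.congr fun m => ?_)
  simp [hitProb, hA, hB]

theorem hitProb_le_of_subset (hω : ∀ x, ω x ∈ Set.Ico (1 / 2 : ℝ) 1) {A A' B B' : Set ℤ}
    (hA : A ⊆ A') (hB : B' ⊆ B) (m : ℕ) :
    ∀ x S, hitProb ω A B m x S ≤ hitProb ω A' B' m x S := by
  induction m with
  | zero =>
    intro x S
    by_cases h : x ∈ A
    · rw [hitProb_of_mem h, hitProb_of_mem (hA h)]
    · have := (hitProb_mem_Icc hω A' B' 0 x S).1
      rwa [hitProb, if_neg h]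
  | succ m ih =>
    intro x S
    by_cases h' : x ∈ A'
    · rw [hitProb_of_mem h']; exact (hitProb_mem_Icc hω A B _ x S).2
    have h : x ∉ A := fun h => h' (hA h)
    by_cases hb : x ∈ B
    · rw [hitProb_of_mem_kill h hb]; exact (hitProb_mem_Icc hω A' B' _ x S).1
    have hb' : x ∉ B' := fun h => hb (hB h)
    simp only [hitProb, if_neg h, if_neg h', if_neg hb, if_neg hb']
    exact stepAvg_mono hω (ih _ _) (ih _ _)

theorem hitLim_le_of_subset (hω : ∀ x, ω x ∈ Set.Ico (1 / 2 : ℝ) 1) {A A' B B' : Set ℤ}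
    (hA : A ⊆ A') (hB : B' ⊆ B) (x : ℤ) (S : Set ℤ) :
    hitLim ω A B x S ≤ hitLim ω A' B' x S :=
  ciSup_mono (bddAbove_hitProb hω A' B' x S) fun m => hitProb_le_of_subset hω hA hB m x S

/-- Marks at or below `a` are never consulted: the chain stops as soon as it gets there. This lets
used sites be replaced by fresh ones behind the target. -/
theorem hitProb_congr {a : ℤ} {B : Set ℤ} (m : ℕ) :
    ∀ (x : ℤ) (S S' : Set ℤ), (∀ z, a < z → (z ∈ S ↔ z ∈ S')) →
      hitProb ω (Set.Iic a) B m x S = hitProb ω (Set.Iic a) B m x S' := by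
  induction m with
  | zero => intro x S S' _; simp [hitProb]
  | succ m ih =>
    intro x S S' h
    by_cases hx : x ∈ Set.Iic a
    · rw [hitProb_of_mem hx, hitProb_of_mem hx]
    · have hp : jumpProb ω x S = jumpProb ω x S' := by
        have := h x (by simpa using hx)
        by_cases hS : x ∈ S
        · rw [jumpProb, jumpProb, if_pos hS, if_pos (this.1 hS)]
        · rw [jumpProb, jumpProb, if_neg hS, if_neg fun h' => hS (this.2 h')]
      have h' : ∀ z, a < z → (z ∈ insert x S ↔ z ∈ insert x S') := fun z hz => by
        simp only [Set.mem_insert_iff, h z hz]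
      simp only [hitProb, if_neg hx, stepAvg, hp, ih _ _ _ h, ih _ _ _ h']

theorem hitLim_congr {a : ℤ} {B : Set ℤ} {x : ℤ} {S S' : Set ℤ}
    (h : ∀ z, a < z → (z ∈ S ↔ z ∈ S')) :
    hitLim ω (Set.Iic a) B x S = hitLim ω (Set.Iic a) B x S' := by
  simp only [hitLim, hitProb_congr _ _ _ _ h]

theorem hitProb_translate {N : ℤ} (hN : ∀ x, ω (x + N) = ω x) {A A' B B' : Set ℤ}
    (hA : ∀ x, x + N ∈ A' ↔ x ∈ A) (hB : ∀ x, x + N ∈ B' ↔ x ∈ B) (m : ℕ) :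
    ∀ (x : ℤ) (S S' : Set ℤ), (∀ z, z + N ∈ S' ↔ z ∈ S) →
      hitProb ω A' B' m (x + N) S' = hitProb ω A B m x S := by
  induction m with
  | zero =>
    intro x S S' _
    by_cases hx : x ∈ A
    · rw [hitProb_of_mem hx, hitProb_of_mem ((hA x).2 hx)]
    · rw [hitProb, hitProb, if_neg hx, if_neg fun h' => hx ((hA x).1 h')]
  | succ m ih =>
    intro x S S' h
    by_cases hx : x ∈ A
    · rw [hitProb_of_mem hx, hitProb_of_mem ((hA x).2 hx)]
    have hx' : x + N ∉ A' := fun h' => hx ((hA x).1 h')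
    by_cases hxB : x ∈ B
    · rw [hitProb_of_mem_kill hx hxB, hitProb_of_mem_kill hx' ((hB x).2 hxB)]
    have hxB' : x + N ∉ B' := fun h' => hxB ((hB x).1 h')
    have hp : jumpProb ω (x + N) S' = jumpProb ω x S := by
      by_cases hS : x ∈ S
      · rw [jumpProb, jumpProb, if_pos hS, if_pos ((h x).2 hS)]
      · rw [jumpProb, jumpProb, if_neg hS, if_neg fun h' => hS ((h x).1 h'), hN]
    have h' : ∀ z, z + N ∈ insert (x + N) S' ↔ z ∈ insert x S := fun z => by
      simp only [Set.mem_insert_iff, h, add_left_inj]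
    have e₁ := ih (x + 1) S S' h
    have e₂ := ih (x - 1) _ _ h'
    rw [show x + 1 + N = x + N + 1 by ring] at e₁
    rw [show x - 1 + N = x + N - 1 by ring] at e₂
    simp only [hitProb, if_neg hx, if_neg hx', if_neg hxB, if_neg hxB', stepAvg, hp, e₁, e₂]

theorem hitLim_translate {N : ℤ} (hN : ∀ x, ω (x + N) = ω x) {A A' B B' : Set ℤ}
    (hA : ∀ x, x + N ∈ A' ↔ x ∈ A) (hB : ∀ x, x + N ∈ B' ↔ x ∈ B) (x : ℤ) :
    hitLim ω A' B' (x + N) ∅ = hitLim ω A B x ∅ := by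
  simp only [hitLim, hitProb_translate hN hA hB _ x ∅ ∅ (by simp)]

/-- In `m` steps the chain cannot get past `b`, so killing there has no effect yet. -/
theorem hitProb_Ici_eq {a b : ℤ} (m : ℕ) :
    ∀ (x : ℤ) (S : Set ℤ), x + m ≤ b →
      hitProb ω (Set.Iic a) (Set.Ici b) m x S = hitProb ω (Set.Iic a) ∅ m x S := by
  induction m with
  | zero => intro x S _; simp [hitProb]
  | succ m ih =>
    intro x S h
    push_cast at h
    have hb : x ∉ Set.Ici b := by simp; omega
    simp only [hitProb, if_neg hb, Set.mem_empty_iff_false, if_false, stepAvg,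
      ih (x + 1) S (by omega), ih (x - 1) (insert x S) (by omega)]

/-! ### Maximum principle and upward gambler's ruin -/

/-- **Maximum principle**: a function which is bounded above on the good states over `[a, b]`,
subharmonic inside and nonpositive at the end points, is nonpositive. -/
theorem nonpos_of_subharmonic (hω : ∀ x, ω x ∈ Set.Ico (1 / 2 : ℝ) 1) {a b : ℤ}
    {f : ℤ → Set ℤ → ℝ} {M : ℝ} (hM : 0 ≤ M)
    (hf : ∀ x S, Good x S → a ≤ x → x ≤ b → f x S ≤ M)
    (ha : ∀ S, Good a S → f a S ≤ 0) (hb : ∀ S, Good b S → f b S ≤ 0)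
    (hsub : ∀ x S, Good x S → a < x → x < b → f x S ≤ stepAvg ω f x S) :
    ∀ x S, Good x S → a ≤ x → x ≤ b → f x S ≤ 0 := by
  -- Lower bound for the chance of jumping right all the way to `b`. Each pass therefore shrinks any
  -- nonnegative upper bound for `f` by the factor `1 - δ`, and iteration drives it to zero.
  set δ : ℝ := (1 / 2) ^ (b - a).toNat with hδ
  have hδ0 : 0 < δ := by positivity
  have hδ1 : δ ≤ 1 := pow_le_one₀ (by norm_num) (by norm_num)
  have improve : ∀ C : ℝ, 0 ≤ C → (∀ x S, Good x S → a ≤ x → x ≤ b → f x S ≤ C) →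
      ∀ x S, Good x S → a ≤ x → x ≤ b → f x S ≤ (1 - δ) * C := by
    intro C hC hfC
    have key : ∀ j : ℕ, ∀ x S, Good x S → a ≤ x → x + j = b →
        f x S ≤ (1 - (1 / 2) ^ j) * C := by
      intro j
      induction j with
      | zero =>
        intro x S hG _ hxb
        obtain rfl : x = b := by simpa using hxb
        simpa using hb S hG
      | succ j ih =>
        intro x S hG hxa hxb
        push_cast at hxb
        have hp1 : ((1 / 2 : ℝ)) ^ (j + 1) ≤ 1 := pow_le_one₀ (by norm_num) (by norm_num)
        rcases hxa.eq_or_lt with rfl | hxa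
        · exact (ha S hG).trans (mul_nonneg (by linarith) hC)
        · refine (hsub x S hG hxa (by omega)).trans ?_
          have h₁ := ih (x + 1) S hG.right (by omega) (by omega)
          have h₂ := hfC (x - 1) _ hG.left (by omega) (by omega)
          have hp := half_le_jumpProb hω x S
          have hp' := jumpProb_le_one hω x S
          unfold stepAvg
          have e₁ := mul_le_mul_of_nonneg_left h₁ (by linarith : 0 ≤ jumpProb ω x S)
          have e₂ := mul_le_mul_of_nonneg_left h₂ (by linarith : 0 ≤ 1 - jumpProb ω x S)
          have e₃ : 1 / 2 * ((1 / 2 : ℝ) ^ j * C) ≤ jumpProb ω x S * ((1 / 2 : ℝ) ^ j * C) :=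
            mul_le_mul_of_nonneg_right hp (by positivity)
          rw [pow_succ]
          nlinarith
    intro x S hG hxa hxb
    have h := key (b - x).toNat x S hG hxa (by omega)
    refine h.trans (mul_le_mul_of_nonneg_right ?_ hC)
    have : δ ≤ (1 / 2 : ℝ) ^ (b - x).toNat :=
      pow_le_pow_of_le_one (by norm_num) (by norm_num) (by omega)
    linarith
  have iter : ∀ k : ℕ, ∀ x S, Good x S → a ≤ x → x ≤ b → f x S ≤ (1 - δ) ^ k * M := by
    intro k
    induction k with
    | zero => simpa using hf
    | succ k ih =>
      have := improve _ (mul_nonneg (pow_nonneg (by linarith) k) hM) ih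
      intro x S hG hxa hxb
      rw [pow_succ', mul_assoc]
      exact this x S hG hxa hxb
  intro x S hG hxa hxb
  have ht : Tendsto (fun k : ℕ => (1 - δ) ^ k * M) atTop (nhds (0 * M)) :=
    (tendsto_pow_atTop_nhds_zero_of_lt_one (by linarith) (by linarith)).mul_const M
  rw [zero_mul] at ht
  exact ge_of_tendsto' ht fun k => iter k x S hG hxa hxb

/-- Upward gambler's ruin: every level to the right is reached with probability one. -/
theorem hitLim_Ici_eq_one (hω : ∀ x, ω x ∈ Set.Ico (1 / 2 : ℝ) 1) (n y : ℤ) :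
    hitLim ω (Set.Ici n) ∅ y ∅ = 1 := by
  rcases le_or_gt n y with h | h
  · exact hitLim_of_mem (Set.mem_Ici.2 h) _
  refine le_antisymm (hitLim_le_one hω _ _ _ _) ?_
  -- Comparison with the symmetric walk killed at `a`: its linear ruin probability is subharmonic
  -- here because every jump has nonnegative drift. Then `a` tends to `-∞`.
  have key : ∀ a : ℤ, a ≤ y → ((y : ℝ) - a) / (n - a) ≤ hitLim ω (Set.Ici n) ∅ y ∅ := by
    intro a ha
    have han : (0 : ℝ) < n - a := by
      have : (a : ℝ) < n := by exact_mod_cast ha.trans_lt h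
      linarith
    refine le_trans ?_ (hitLim_le_of_subset hω (le_refl _) (Set.empty_subset (Set.Iic a)) y ∅)
    have := nonpos_of_subharmonic hω (a := a) (b := n) (M := 1)
      (f := fun x S => ((x : ℝ) - a) / (n - a) - hitLim ω (Set.Ici n) (Set.Iic a) x S)
      zero_le_one ?_ ?_ ?_ ?_ y ∅ (good_empty y) ha h.le
    · simpa using this
    · intro x S _ _ hxn
      have hxn' : (x : ℝ) ≤ n := by exact_mod_cast hxn
      have : ((x : ℝ) - a) / (n - a) ≤ 1 := (div_le_one han).2 (by linarith)
      linarith [hitLim_nonneg hω (Set.Ici n) (Set.Iic a) x S]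
    · intro S _
      simp [hitLim_nonneg hω]
    · intro S _
      rw [hitLim_of_mem (by simp), div_self han.ne']; simp
    · intro x S _ hxa hxn
      have e := hitLim_eq_stepAvg hω (A := Set.Ici n) (B := Set.Iic a) (x := x)
        (by simpa using hxn) (by simpa using hxa) S
      simp only [e]
      have hp := half_le_jumpProb hω x S
      have : ((x : ℝ) - a) / (n - a) ≤ jumpProb ω x S * (((x : ℝ) + 1 - a) / (n - a)) +
          (1 - jumpProb ω x S) * (((x : ℝ) - 1 - a) / (n - a)) := by
        rw [← mul_div_assoc, ← mul_div_assoc, ← add_div]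
        exact div_le_div_of_nonneg_right (by nlinarith) han.le
      unfold stepAvg
      push_cast
      linarith
  have ht : Tendsto (fun k : ℕ => ((k : ℝ)) / (k + (n - y : ℝ))) atTop (nhds 1) := by
    simpa using tendsto_natCast_div_add_atTop (𝕜 := ℝ) ((n : ℝ) - y)
  refine le_of_tendsto' ht fun k => ?_
  have := key (y - k) (by omega)
  push_cast at this
  have e : ((y : ℝ) - (y - k)) / (n - (y - k)) = k / (k + (n - y)) := by congr 1 <;> ring
  rwa [e] at this

end

/-! ### Site drifts and the optional stopping identity -/

/-- The mean total drift provided by the site `z`: a drift of `2 * ω z - 1` on each visit up to the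
first left jump from `z`. -/
noncomputable def siteDrift (ω : ℤ → ℝ) (z : ℤ) : ℝ := (2 * ω z - 1) / (1 - ω z)

/-- The probability that the walk started at `x` in the fresh environment makes a left jump from `x`
before reaching `n`. -/
noncomputable def leftBefore (ω : ℤ → ℝ) (x n : ℤ) : ℝ :=
  hitLim ω (Set.Iic (x - 1)) (Set.Ici n) x ∅

/-- The probability that the walk started at `x` in the fresh environment never reaches `x - 1`. -/
noncomputable def escapeProb (ω : ℤ → ℝ) (x : ℤ) : ℝ := 1 - hitLim ω (Set.Iic (x - 1)) ∅ x ∅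

open Classical in
/-- For the walk started at `x`, stopped on leaving `[x, n)`: the conditional probability, given the
current state `(w, S)`, that a left jump from `z` occurs. -/
noncomputable def leftJumpProb (ω : ℤ → ℝ) (x n z w : ℤ) (S : Set ℤ) : ℝ :=
  if z ∈ S then 1 else
    if z ≤ w then hitLim ω (Set.Iic (z - 1)) (Set.Ici n) w S else
      (1 - hitLim ω (Set.Iic (x - 1)) (Set.Ici z) w S) * leftBefore ω z n

section

variable {ω : ℤ → ℝ}

theorem siteDrift_nonneg (hω : ∀ x, ω x ∈ Set.Ico (1 / 2 : ℝ) 1) (z : ℤ) : 0 ≤ siteDrift ω z :=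
  div_nonneg (by linarith [(hω z).1]) (by linarith [(hω z).2])

theorem leftBefore_nonneg (hω : ∀ x, ω x ∈ Set.Ico (1 / 2 : ℝ) 1) (x n : ℤ) :
    0 ≤ leftBefore ω x n := hitLim_nonneg hω _ _ _ _

theorem leftBefore_le_one (hω : ∀ x, ω x ∈ Set.Ico (1 / 2 : ℝ) 1) (x n : ℤ) :
    leftBefore ω x n ≤ 1 := hitLim_le_one hω _ _ _ _

theorem leftBefore_mono (hω : ∀ x, ω x ∈ Set.Ico (1 / 2 : ℝ) 1) (x : ℤ) :
    Monotone (leftBefore ω x) := fun _ _ h =>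
  hitLim_le_of_subset hω le_rfl (Set.Ici_subset_Ici.2 h) _ _

theorem leftBefore_le_escapeProb (hω : ∀ x, ω x ∈ Set.Ico (1 / 2 : ℝ) 1) (x n : ℤ) :
    leftBefore ω x n ≤ 1 - escapeProb ω x := by
  unfold escapeProb
  linarith [hitLim_le_of_subset hω (le_refl (Set.Iic (x - 1))) (Set.empty_subset (Set.Ici n)) x ∅,
    show leftBefore ω x n = hitLim ω (Set.Iic (x - 1)) (Set.Ici n) x ∅ from rfl]

theorem leftBefore_self (x : ℤ) : leftBefore ω x x = 0 :=
  hitLim_of_mem_kill (by simp) (by simp) _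

/-- Squeeze: `r` steps cannot get beyond `x + r`, so the `r`-step hitting probability without
killing is a lower bound. -/
theorem tendsto_leftBefore (hω : ∀ x, ω x ∈ Set.Ico (1 / 2 : ℝ) 1) (x : ℤ) :
    Tendsto (fun r : ℕ => leftBefore ω x (x + r)) atTop (nhds (1 - escapeProb ω x)) := by
  refine tendsto_of_tendsto_of_tendsto_of_le_of_le
    (g := fun r : ℕ => hitProb ω (Set.Iic (x - 1)) ∅ r x ∅) ?_ tendsto_const_nhds ?_
    (fun r => leftBefore_le_escapeProb hω x _)
  · simpa [escapeProb] using tendsto_hitProb hω (Set.Iic (x - 1)) ∅ x ∅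
  · intro r
    change hitProb ω (Set.Iic (x - 1)) ∅ r x ∅ ≤ leftBefore ω x (x + r)
    rw [← hitProb_Ici_eq (b := x + r) r x ∅ le_rfl]
    exact hitProb_le_hitLim hω _ _ _ _ _

theorem escapeProb_nonneg (hω : ∀ x, ω x ∈ Set.Ico (1 / 2 : ℝ) 1) (x : ℤ) :
    0 ≤ escapeProb ω x := sub_nonneg.2 (hitLim_le_one hω _ _ _ _)

theorem escapeProb_le_one (hω : ∀ x, ω x ∈ Set.Ico (1 / 2 : ℝ) 1) (x : ℤ) :
    escapeProb ω x ≤ 1 := by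
  unfold escapeProb; linarith [hitLim_nonneg hω (Set.Iic (x - 1)) ∅ x ∅]

theorem leftJumpProb_mem_Icc (hω : ∀ x, ω x ∈ Set.Ico (1 / 2 : ℝ) 1) (x n z w : ℤ) (S : Set ℤ) :
    leftJumpProb ω x n z w S ∈ Set.Icc (0 : ℝ) 1 := by
  unfold leftJumpProb
  split_ifs
  · simp
  · exact ⟨hitLim_nonneg hω _ _ _ _, hitLim_le_one hω _ _ _ _⟩
  · have h₁ := hitLim_nonneg hω (Set.Iic (x - 1)) (Set.Ici z) w S
    have h₂ := hitLim_le_one hω (Set.Iic (x - 1)) (Set.Ici z) w S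
    exact ⟨mul_nonneg (by linarith) (leftBefore_nonneg hω _ _),
      mul_le_one₀ (by linarith) (leftBefore_nonneg hω _ _) (leftBefore_le_one hω _ _)⟩

theorem leftJumpProb_of_mem {x n z w : ℤ} {S : Set ℤ} (h : z ∈ S) :
    leftJumpProb ω x n z w S = 1 := by simp [leftJumpProb, h]

theorem leftJumpProb_of_le {x n z w : ℤ} {S : Set ℤ} (h : z ∉ S) (hz : z ≤ w) :
    leftJumpProb ω x n z w S = hitLim ω (Set.Iic (z - 1)) (Set.Ici n) w S := by
  simp [leftJumpProb, h, hz]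

theorem leftJumpProb_of_lt {x n z w : ℤ} {S : Set ℤ} (h : z ∉ S) (hz : w < z) :
    leftJumpProb ω x n z w S =
      (1 - hitLim ω (Set.Iic (x - 1)) (Set.Ici z) w S) * leftBefore ω z n := by
  simp [leftJumpProb, h, hz]

theorem Good.not_mem {w z u : ℤ} {S : Set ℤ} (hG : Good w S) (hz : w < z) (h : z ∉ S)
    (hu : z ≤ u) : u ∉ S := fun hS => h (hG z u hz hu hS)

/-- A conditional probability of a fixed event is a martingale. The cases match at the interfaces: a
left step from `z` itself realises the event, and a right step into an unmarked `z` finds fresh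
ground from `z` onward because the state is good. -/
theorem leftJumpProb_eq_stepAvg (hω : ∀ x, ω x ∈ Set.Ico (1 / 2 : ℝ) 1) {x n z w : ℤ}
    {S : Set ℤ} (hG : Good w S) (hxw : x ≤ w) (hwn : w < n) :
    leftJumpProb ω x n z w S = stepAvg ω (leftJumpProb ω x n z) w S := by
  by_cases hzS : z ∈ S
  · rw [stepAvg, leftJumpProb_of_mem hzS, leftJumpProb_of_mem hzS,
      leftJumpProb_of_mem (Set.mem_insert_of_mem _ hzS)]; ring
  rcases lt_trichotomy z w with hz | rfl | hz
  · have hz' : z ∉ insert w S := by simp [hz.ne, hzS]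
    rw [stepAvg, leftJumpProb_of_le hzS hz.le, leftJumpProb_of_le hzS (by omega),
      leftJumpProb_of_le hz' (by omega),
      hitLim_eq_stepAvg hω (by simpa using hz.le) (by simpa using hwn), stepAvg]
  · rw [stepAvg, leftJumpProb_of_le hzS le_rfl, leftJumpProb_of_le hzS (by omega),
      leftJumpProb_of_mem (Set.mem_insert _ _),
      hitLim_eq_stepAvg hω (by simp) (by simpa using hwn), stepAvg,
      hitLim_of_mem (x := z - 1) (by simp)]
  · have hz' : z ∉ insert w S := by simp [hz.ne', hzS]
    rw [stepAvg, leftJumpProb_of_lt hzS hz, leftJumpProb_of_lt hz' (by omega),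
      hitLim_eq_stepAvg hω (by simpa using hxw) (by simpa using hz), stepAvg]
    have key : leftJumpProb ω x n z (w + 1) S =
        (1 - hitLim ω (Set.Iic (x - 1)) (Set.Ici z) (w + 1) S) * leftBefore ω z n := by
      rcases (show w + 1 ≤ z from hz).eq_or_lt with rfl | hlt
      · have h0 : hitLim ω (Set.Iic (x - 1)) (Set.Ici (w + 1)) (w + 1) S = 0 :=
          hitLim_of_mem_kill (by simp; omega) (by simp) S
        rw [leftJumpProb_of_le hzS le_rfl, h0, leftBefore, sub_zero, one_mul]
        refine hitLim_congr fun u hu => ?_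
        simp [hG.not_mem hz hzS (show w + 1 ≤ u by omega)]
      · exact leftJumpProb_of_lt hzS hlt
    rw [key]; ring

open Classical in
/-- Optional stopping for the martingale `X - ∑ siteDrift` on exit from `[x, n)`. -/
theorem mul_one_sub_leftBefore (hω : ∀ x, ω x ∈ Set.Ico (1 / 2 : ℝ) 1) {x n : ℤ} (hxn : x < n) :
    ((n : ℝ) - x + 1) * (1 - leftBefore ω x n) =
      1 + ∑ z ∈ Finset.Ico x n, siteDrift ω z *
        ((1 - leftBefore ω x z) * leftBefore ω z n) := by
  -- `φ z` is the conditional probability that the first left jump from `z` is still to come. `V` is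
  -- the expected exit position minus the current position and the expected drift still to be
  -- collected. It is harmonic inside and zero at both exits, hence zero; its value at `(x, ∅)` is
  -- the identity.
  set φ : ℤ → ℤ → Set ℤ → ℝ :=
    fun z w S => leftJumpProb ω x n z w S - if z ∈ S then 1 else 0 with hφ
  set V : ℤ → Set ℤ → ℝ := fun w S =>
    ((x : ℝ) - 1) + (n - x + 1) * (1 - hitLim ω (Set.Iic (x - 1)) (Set.Ici n) w S) - w -
      ∑ z ∈ Finset.Ico x n, siteDrift ω z * φ z w S with hV
  have hφ0 : ∀ z w S, 0 ≤ φ z w S ∧ φ z w S ≤ 1 := by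
    intro z w S
    have := leftJumpProb_mem_Icc hω x n z w S
    simp only [hφ]
    split_ifs with h
    · rw [leftJumpProb_of_mem h]; simp
    · simpa using this
  have hφa : ∀ z ∈ Finset.Ico x n, ∀ S, φ z (x - 1) S = 0 := by
    intro z hz S
    rw [Finset.mem_Ico] at hz
    simp only [hφ]
    split_ifs with h
    · rw [leftJumpProb_of_mem h]; simp
    · rw [leftJumpProb_of_lt h (by omega), hitLim_of_mem (by simp)]; simp
  have hφb : ∀ z ∈ Finset.Ico x n, ∀ S, φ z n S = 0 := by
    intro z hz S
    rw [Finset.mem_Ico] at hz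
    simp only [hφ]
    split_ifs with h
    · rw [leftJumpProb_of_mem h]; simp
    · rw [leftJumpProb_of_le h hz.2.le, hitLim_of_mem_kill (by simp; omega) (by simp)]; simp
  have hVa : ∀ S, V (x - 1) S = 0 := by
    intro S
    simp only [hV]
    rw [Finset.sum_eq_zero fun z hz => by rw [hφa z hz, mul_zero], hitLim_of_mem (by simp)]
    push_cast; ring
  have hVb : ∀ S, V n S = 0 := by
    intro S
    simp only [hV]
    rw [Finset.sum_eq_zero fun z hz => by rw [hφb z hz, mul_zero],
      hitLim_of_mem_kill (by simp; omega) (by simp)]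
    ring
  -- `φ z` decreases on average only when the walker stands on `z` still unmarked, and then by the
  -- chance `1 - ω w` of a left jump. The factor `siteDrift` turns this loss into the one-step drift
  -- `2 * ω w - 1`.
  have hstep : ∀ z w S, Good w S → x - 1 < w → w < n →
      stepAvg ω (φ z) w S = φ z w S - if z = w ∧ w ∉ S then 1 - ω w else 0 := by
    intro z w S hG hxw hwn
    have e := leftJumpProb_eq_stepAvg hω (x := x) (z := z) hG (by omega) hwn
    simp only [stepAvg, hφ] at e ⊢
    rw [e]
    by_cases hzS : z ∈ S
    · have : ¬ (z = w ∧ w ∉ S) := fun h => h.2 (h.1 ▸ hzS)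
      rw [if_pos hzS, if_pos (Set.mem_insert_of_mem _ hzS), if_neg this]; ring
    · by_cases hzw : z = w
      · subst hzw
        rw [if_neg hzS, if_pos (Set.mem_insert _ _), if_pos ⟨rfl, hzS⟩, jumpProb, if_neg hzS]
        ring
      · have : z ∉ insert w S := by simp [hzw, hzS]
        rw [if_neg hzS, if_neg this, if_neg fun h => hzw h.1]; ring
  have hharm : ∀ w S, Good w S → x - 1 < w → w < n → stepAvg ω V w S = V w S := by
    intro w S hG hxw hwn
    have e := hitLim_eq_stepAvg hω (A := Set.Iic (x - 1)) (B := Set.Ici n) (x := w)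
      (by simpa using hxw) (by simpa using hwn) S
    have hsum : jumpProb ω w S * (∑ z ∈ Finset.Ico x n, siteDrift ω z * φ z (w + 1) S) +
        (1 - jumpProb ω w S) *
          (∑ z ∈ Finset.Ico x n, siteDrift ω z * φ z (w - 1) (insert w S)) =
        (∑ z ∈ Finset.Ico x n, siteDrift ω z * φ z w S) -
          if w ∉ S then 2 * ω w - 1 else 0 := by
      have h₁ : ∀ z ∈ Finset.Ico x n, jumpProb ω w S * (siteDrift ω z * φ z (w + 1) S) +
          (1 - jumpProb ω w S) * (siteDrift ω z * φ z (w - 1) (insert w S)) =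
          siteDrift ω z * φ z w S - if w = z then (if w ∉ S then 2 * ω w - 1 else 0) else 0 := by
        intro z _
        have h := hstep z w S hG hxw hwn
        rw [stepAvg] at h
        have : siteDrift ω z * (if z = w ∧ w ∉ S then 1 - ω w else 0) =
            if w = z then (if w ∉ S then 2 * ω w - 1 else 0) else 0 := by
          by_cases hzw : z = w
          · subst hzw
            by_cases hS : z ∈ S
            · simp [hS]
            · have : 1 - ω z ≠ 0 := by linarith [(hω z).2]
              simp [hS, siteDrift, div_mul_cancel₀ _ this]
          · simp [hzw, Ne.symm hzw]
        rw [← this, ← mul_sub, ← h]; ring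
      rw [Finset.mul_sum, Finset.mul_sum, ← Finset.sum_add_distrib, Finset.sum_congr rfl h₁,
        Finset.sum_sub_distrib, Finset.sum_ite_eq, if_pos (Finset.mem_Ico.2 ⟨by omega, hwn⟩)]
    have hdrift : 2 * jumpProb ω w S - 1 = if w ∉ S then 2 * ω w - 1 else 0 := by
      by_cases hS : w ∈ S <;> simp [jumpProb, hS]
    rw [← hdrift] at hsum
    simp only [stepAvg, hV] at e ⊢
    rw [e]
    push_cast
    linear_combination -hsum
  have hVbound : ∀ w S, x - 1 ≤ w → w ≤ n →
      |V w S| ≤ (n - x + 1) + ∑ z ∈ Finset.Ico x n, siteDrift ω z := by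
    intro w S hxw hwn
    have hxw' : (x : ℝ) - 1 ≤ w := by exact_mod_cast hxw
    have hwn' : (w : ℝ) ≤ n := by exact_mod_cast hwn
    have h₀ : 0 ≤ ∑ z ∈ Finset.Ico x n, siteDrift ω z * φ z w S :=
      Finset.sum_nonneg fun z _ => mul_nonneg (siteDrift_nonneg hω z) (hφ0 z w S).1
    have h₁ : ∑ z ∈ Finset.Ico x n, siteDrift ω z * φ z w S ≤
        ∑ z ∈ Finset.Ico x n, siteDrift ω z :=
      Finset.sum_le_sum fun z _ => mul_le_of_le_one_right (siteDrift_nonneg hω z) (hφ0 z w S).2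
    have h₂ := hitLim_nonneg hω (Set.Iic (x - 1)) (Set.Ici n) w S
    have h₃ := hitLim_le_one hω (Set.Iic (x - 1)) (Set.Ici n) w S
    have h₄ : 0 ≤ (n - x + 1 : ℝ) * (1 - hitLim ω (Set.Iic (x - 1)) (Set.Ici n) w S) :=
      mul_nonneg (by linarith) (by linarith)
    have h₅ : (n - x + 1 : ℝ) * (1 - hitLim ω (Set.Iic (x - 1)) (Set.Ici n) w S) ≤ n - x + 1 :=
      mul_le_of_le_one_right (by linarith) (by linarith)
    rw [abs_le]
    simp only [hV]
    constructor <;> linarith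
  have hM : 0 ≤ ((n : ℝ) - x + 1) + ∑ z ∈ Finset.Ico x n, siteDrift ω z :=
    (abs_nonneg _).trans (hVbound x ∅ (by omega) hxn.le)
  have hle : V x ∅ ≤ 0 := nonpos_of_subharmonic hω (a := x - 1) (b := n) hM
    (fun w S _ h₁ h₂ => (le_abs_self _).trans (hVbound w S h₁ h₂))
    (fun S _ => (hVa S).le) (fun S _ => (hVb S).le)
    (fun w S hG h₁ h₂ => (hharm w S hG h₁ h₂).ge) x ∅ (good_empty x) (by omega) hxn.le
  have hge : -V x ∅ ≤ 0 := nonpos_of_subharmonic hω (a := x - 1) (b := n) (f := fun w S => -V w S)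
    hM (fun w S _ h₁ h₂ => (neg_le_abs _).trans (hVbound w S h₁ h₂))
    (fun S _ => by simp [hVa S]) (fun S _ => by simp [hVb S])
    (fun w S hG h₁ h₂ => by
      have := hharm w S hG h₁ h₂
      simp only [stepAvg] at this ⊢
      linarith) x ∅ (good_empty x) (by omega) hxn.le
  have hV0 : V x ∅ = 0 := by linarith
  have hφx : ∀ z ∈ Finset.Ico x n, φ z x ∅ = (1 - leftBefore ω x z) * leftBefore ω z n := by
    intro z hz
    rw [Finset.mem_Ico] at hz
    simp only [hφ]
    rw [if_neg (Set.notMem_empty z), sub_zero]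
    rcases hz.1.eq_or_lt with rfl | hlt
    · rw [leftJumpProb_of_le (Set.notMem_empty _) le_rfl, leftBefore_self]; simp [leftBefore]
    · rw [leftJumpProb_of_lt (Set.notMem_empty _) hlt]; rfl
  simp only [hV] at hV0
  rw [Finset.sum_congr rfl fun z hz => by rw [hφx z hz]] at hV0
  change _ + _ * (1 - leftBefore ω x n) - _ - _ = _ at hV0
  linarith

/-! ### Consequences for general environments -/

/-- Reaching `z ≤ n` before `x - 1` is at least as likely as reaching `n`, so `1 - leftBefore ω x n`
can be factored out of the optional stopping identity and cancelled. -/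
theorem sum_siteDrift_mul_leftBefore_le (hω : ∀ x, ω x ∈ Set.Ico (1 / 2 : ℝ) 1) {x n : ℤ}
    (hxn : x < n) :
    ∑ z ∈ Finset.Ico x n, siteDrift ω z * leftBefore ω z n ≤ n - x + 1 := by
  have e := mul_one_sub_leftBefore hω hxn
  have hxn' : (x : ℝ) < n := by exact_mod_cast hxn
  have hs : 0 < 1 - leftBefore ω x n := by
    have h₀ : 0 ≤ ∑ z ∈ Finset.Ico x n, siteDrift ω z *
        ((1 - leftBefore ω x z) * leftBefore ω z n) :=
      Finset.sum_nonneg fun z _ => mul_nonneg (siteDrift_nonneg hω z)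
        (mul_nonneg (by linarith [leftBefore_le_one hω x z]) (leftBefore_nonneg hω _ _))
    exact pos_of_mul_pos_right (by linarith : 0 < ((n : ℝ) - x + 1) * (1 - leftBefore ω x n))
      (by linarith)
  have h₁ : (1 - leftBefore ω x n) * ∑ z ∈ Finset.Ico x n, siteDrift ω z * leftBefore ω z n ≤
      ∑ z ∈ Finset.Ico x n, siteDrift ω z * ((1 - leftBefore ω x z) * leftBefore ω z n) := by
    rw [Finset.mul_sum]
    refine Finset.sum_le_sum fun z hz => ?_
    rw [mul_left_comm]
    refine mul_le_mul_of_nonneg_left (mul_le_mul_of_nonneg_right ?_ (leftBefore_nonneg hω _ _))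
      (siteDrift_nonneg hω z)
    linarith [leftBefore_mono hω x (Finset.mem_Ico.1 hz).2.le]
  refine le_of_mul_le_mul_left ?_ hs
  linarith

/-- One way to avoid `m - 1` is to jump right at once and never come back to `m`. -/
theorem mul_escapeProb_succ_le (hω : ∀ x, ω x ∈ Set.Ico (1 / 2 : ℝ) 1) (m : ℤ) :
    ω m * escapeProb ω (m + 1) ≤ escapeProb ω m := by
  have e := hitLim_eq_stepAvg hω (A := Set.Iic (m - 1)) (B := ∅) (x := m) (by simp) (by simp) ∅
  have hj : jumpProb ω m ∅ = ω m := by simp [jumpProb]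
  rw [stepAvg, hitLim_of_mem (x := m - 1) (by simp), hj] at e
  have h := hitLim_le_of_subset hω (A := Set.Iic (m - 1)) (A' := Set.Iic (m + 1 - 1))
    (Set.Iic_subset_Iic.2 (by omega)) (le_refl ∅) (m + 1) ∅
  have := mul_le_mul_of_nonneg_left h (by linarith [(hω m).1] : 0 ≤ ω m)
  unfold escapeProb
  rw [e]
  linarith

/-- Certainty propagates to the right: an average equal to 1 of values at most 1, with positive
weight on the right jump, forces value 1 after that jump, which leaves the environment fresh. No
restart in a used environment is needed. -/
theorem hitLim_Iic_eq_one (hω : ∀ x, ω x ∈ Set.Ico (1 / 2 : ℝ) 1)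
    (hq : ∀ x, escapeProb ω x = 0) (a : ℤ) (x : ℤ) :
    hitLim ω (Set.Iic a) ∅ x ∅ = 1 := by
  rcases le_or_gt x a with h | h
  · exact hitLim_of_mem (Set.mem_Iic.2 h) _
  obtain ⟨k, rfl⟩ : ∃ k : ℕ, x = a + 1 + k := ⟨(x - a - 1).toNat, by omega⟩
  clear h
  induction k with
  | zero =>
    have := hq (a + 1)
    rw [escapeProb, add_sub_cancel_right] at this
    simp only [Nat.cast_zero, add_zero]
    linarith
  | succ k ih =>
    have e := hitLim_eq_stepAvg hω (A := Set.Iic a) (B := ∅) (x := a + 1 + k)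
      (by simp; omega) (by simp) ∅
    have hj : jumpProb ω (a + 1 + k) ∅ = ω (a + 1 + k) := by simp [jumpProb]
    rw [ih, stepAvg, hj] at e
    have h₁ := hitLim_le_one hω (Set.Iic a) ∅ (a + 1 + k + 1) ∅
    have h₂ := hitLim_le_one hω (Set.Iic a) ∅ (a + 1 + k - 1) (insert (a + 1 + k) ∅)
    have hp := hω (a + 1 + k)
    have e₂ := mul_le_mul_of_nonneg_left h₂ (by linarith [hp.2] : 0 ≤ 1 - ω (a + 1 + k))
    push_cast
    rw [← add_assoc]
    refine le_antisymm h₁ (le_of_mul_le_mul_left ?_ (by linarith [hp.1] : 0 < ω (a + 1 + k)))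
    linarith

/-! ### Periodic environments: the critical mean drift -/

theorem periodic_mul {N : ℕ} (hN : ∀ x : ℤ, ω (x + N) = ω x) (l : ℕ) (x : ℤ) :
    ω (x + l * N) = ω x := by
  induction l with
  | zero => simp
  | succ l ih => push_cast; rw [add_mul, one_mul, ← add_assoc, hN, ih]

theorem siteDrift_translate {N : ℤ} (hN : ∀ x, ω (x + N) = ω x) (z : ℤ) :
    siteDrift ω (z + N) = siteDrift ω z := by simp only [siteDrift, hN]

theorem leftBefore_translate {N : ℤ} (hN : ∀ x, ω (x + N) = ω x) (z n : ℤ) :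
    leftBefore ω (z + N) (n + N) = leftBefore ω z n :=
  hitLim_translate hN (fun x => by simp only [Set.mem_Iic]; omega) (fun x => by simp) z

theorem escapeProb_translate {N : ℤ} (hN : ∀ x, ω (x + N) = ω x) (z : ℤ) :
    escapeProb ω (z + N) = escapeProb ω z := by
  unfold escapeProb
  rw [hitLim_translate hN (A := Set.Iic (z - 1)) (B := ∅) (fun x => by simp only [Set.mem_Iic]; omega)
    (fun x => by simp) z]

theorem sum_Ico_eq_sum_range_sum {N : ℕ} (f : ℤ → ℝ) (L : ℕ) :
    ∑ z ∈ Finset.Ico (1 : ℤ) (L * N + 1), f z =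
      ∑ l ∈ Finset.range L, ∑ z ∈ Finset.Icc (1 : ℤ) N, f (z + l * N) := by
  induction L with
  | zero => simp
  | succ L ih =>
    have h₀ : (0 : ℤ) ≤ L * N := by positivity
    have h₁ : (1 : ℤ) ≤ L * N + 1 := by omega
    have h₂ : (L * N + 1 : ℤ) ≤ (L + 1 : ℕ) * N + 1 := by push_cast; nlinarith
    rw [Finset.sum_range_succ, ← ih, ← Finset.Ico_union_Ico_eq_Ico h₁ h₂,
      Finset.sum_union (Finset.Ico_disjoint_Ico_consecutive _ _ _)]
    congr 1
    rw [← Finset.sum_image (f := f) (g := fun z : ℤ => z + L * N) (s := Finset.Icc (1 : ℤ) N)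
      (fun a _ b _ h => by simpa using h), Finset.image_add_right_Icc]
    refine Finset.sum_congr ?_ fun _ _ => rfl
    ext z
    simp only [Finset.mem_Ico, Finset.mem_Icc]
    push_cast
    rw [add_mul]
    omega

/-- Subcriticality bound for the escape probabilities in a periodic environment. -/
theorem sum_siteDrift_mul_le (hω : ∀ x, ω x ∈ Set.Ico (1 / 2 : ℝ) 1) {N : ℕ}
    (hN : ∀ x : ℤ, ω (x + N) = ω x) :
    ∑ z ∈ Finset.Icc (1 : ℤ) N, siteDrift ω z * (1 - escapeProb ω z) ≤ N := by
  have hB : ∀ r : ℕ, ∑ z ∈ Finset.Icc (1 : ℤ) N, siteDrift ω z * leftBefore ω z (z + r) ≤ N := by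
    intro r
    have hL : ∀ L : ℕ, (L : ℝ) * ∑ z ∈ Finset.Icc (1 : ℤ) N,
        siteDrift ω z * leftBefore ω z (z + r) ≤ L * N + (r + 2) := by
      intro L
      have h₀ : (0 : ℤ) ≤ L * N := by positivity
      -- The margin beyond the `L` periods makes `z + r` lie below the right end for every `z` in
      -- them; its cost `r + 2` vanishes after division by the number of periods.
      have h := sum_siteDrift_mul_leftBefore_le hω (x := 1) (n := L * N + 1 + (r + 1)) (by omega)
      have hsub : ∑ z ∈ Finset.Ico (1 : ℤ) (L * N + 1), siteDrift ω z *
          leftBefore ω z (L * N + 1 + (r + 1)) ≤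
          ∑ z ∈ Finset.Ico (1 : ℤ) (L * N + 1 + (r + 1)), siteDrift ω z *
          leftBefore ω z (L * N + 1 + (r + 1)) :=
        Finset.sum_le_sum_of_subset_of_nonneg (Finset.Ico_subset_Ico_right (by omega))
          fun z _ _ => mul_nonneg (siteDrift_nonneg hω z) (leftBefore_nonneg hω _ _)
      rw [sum_Ico_eq_sum_range_sum] at hsub
      have hlow : (L : ℝ) * ∑ z ∈ Finset.Icc (1 : ℤ) N,
          siteDrift ω z * leftBefore ω z (z + r) ≤
          ∑ l ∈ Finset.range L, ∑ z ∈ Finset.Icc (1 : ℤ) N, siteDrift ω (z + l * N) *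
            leftBefore ω (z + l * N) (L * N + 1 + (r + 1)) := by
        rw [← nsmul_eq_mul, ← Finset.card_range L, ← Finset.sum_const, Finset.card_range]
        refine Finset.sum_le_sum fun l hl => Finset.sum_le_sum fun z hz => ?_
        have hp := periodic_mul hN l
        rw [siteDrift_translate hp, ← leftBefore_translate hp z (z + r)]
        refine mul_le_mul_of_nonneg_left (leftBefore_mono hω _ ?_) (siteDrift_nonneg hω z)
        rw [Finset.mem_range] at hl
        rw [Finset.mem_Icc] at hz
        have : (l + 1 : ℤ) * N ≤ L * N :=
          mul_le_mul_of_nonneg_right (by omega) (by positivity)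
        rw [add_mul] at this
        omega
      push_cast at h
      linarith
    have ht : Tendsto (fun L : ℕ => (N : ℝ) + (r + 2) / ((L : ℝ) + 1)) atTop (nhds (N + 0)) :=
      ((tendsto_const_div_atTop_nhds_zero_nat ((r : ℝ) + 2)).comp
        (tendsto_add_atTop_nat 1)).const_add _ |>.congr fun L => by simp
    rw [add_zero] at ht
    refine ge_of_tendsto' ht fun L => ?_
    have h := hL (L + 1)
    push_cast at h
    have hpos : (0 : ℝ) < L + 1 := by positivity
    refine le_of_mul_le_mul_left ?_ hpos
    rw [mul_add, mul_div_cancel₀ _ hpos.ne']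
    exact h
  refine le_of_tendsto' (x := atTop) (f := fun r : ℕ => ∑ z ∈ Finset.Icc (1 : ℤ) N,
    siteDrift ω z * leftBefore ω z (z + r)) ?_ hB
  exact tendsto_finsetSum _ fun z _ => (tendsto_leftBefore hω z).const_mul _

/-- Supercriticality bound for the escape probabilities in a periodic environment. -/
theorem le_sum_siteDrift_mul (hω : ∀ x, ω x ∈ Set.Ico (1 / 2 : ℝ) 1) {N : ℕ} (hN1 : 1 ≤ N)
    (hN : ∀ x : ℤ, ω (x + N) = ω x) (hq : 0 < escapeProb ω 1) :
    N ≤ ∑ z ∈ Finset.Icc (1 : ℤ) N, siteDrift ω z * (1 - escapeProb ω z) := by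
  set A := ∑ z ∈ Finset.Icc (1 : ℤ) N, siteDrift ω z * (1 - escapeProb ω z) with hA
  set s : ℕ → ℝ := fun l => 1 - leftBefore ω 1 (1 + l * N) with hs
  have hst : Tendsto s atTop (nhds (escapeProb ω 1)) := by
    have h₁ : Tendsto (fun l : ℕ => l * N) atTop atTop := tendsto_id.atTop_mul_const' hN1
    have h₂ := ((tendsto_leftBefore hω 1).comp h₁).const_sub 1
    rw [sub_sub_cancel] at h₂
    refine h₂.congr fun l => ?_
    simp [hs]
  -- The identity on `L + 1` periods: within period `l`, the chance of reaching `z` is at most that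
  -- of reaching the start of the period, `s l`, and `leftBefore` is at most `1 - escapeProb`.
  have hmain : ∀ L : ℕ, ((L + 1 : ℕ) : ℝ) * N * escapeProb ω 1 ≤
      1 + A * ∑ l ∈ Finset.range (L + 1), s l := by
    intro L
    set n : ℤ := (L + 1 : ℕ) * N + 1 with hn
    have h₀ : (0 : ℤ) < (L + 1 : ℕ) * N := by positivity
    have e := mul_one_sub_leftBefore hω (x := 1) (n := n) (by omega)
    rw [hn, sum_Ico_eq_sum_range_sum, ← hn] at e
    have hup : ∑ l ∈ Finset.range (L + 1), ∑ z ∈ Finset.Icc (1 : ℤ) N,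
        siteDrift ω (z + l * N) * ((1 - leftBefore ω 1 (z + l * N)) *
          leftBefore ω (z + l * N) n) ≤ A * ∑ l ∈ Finset.range (L + 1), s l := by
      rw [Finset.mul_sum]
      refine Finset.sum_le_sum fun l _ => ?_
      rw [hA, Finset.sum_mul]
      refine Finset.sum_le_sum fun z hz => ?_
      have hp := periodic_mul hN l
      rw [siteDrift_translate hp, mul_assoc, mul_comm (1 - escapeProb ω z)]
      refine mul_le_mul_of_nonneg_left ?_ (siteDrift_nonneg hω z)
      rw [← escapeProb_translate hp z]
      refine mul_le_mul ?_ (leftBefore_le_escapeProb hω _ _) (leftBefore_nonneg hω _ _) ?_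
      · have := leftBefore_mono hω 1 (show (1 : ℤ) + l * N ≤ z + l * N by
          linarith [(Finset.mem_Icc.1 hz).1])
        simp only [hs]; linarith
      · simp only [hs]; linarith [leftBefore_le_one hω 1 (1 + l * N)]
    have hq' := leftBefore_le_escapeProb hω 1 n
    have hn' : (n : ℝ) = ((L + 1 : ℕ) : ℝ) * N + 1 := by rw [hn]; push_cast; ring
    have hn0 : (0 : ℝ) ≤ ((L + 1 : ℕ) : ℝ) * N := by positivity
    rw [hn'] at e
    push_cast at e hn0 ⊢
    have : ((L + 1 : ℝ) * N) * escapeProb ω 1 ≤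
        ((L + 1 : ℝ) * N + 1 - 1 + 1) * (1 - leftBefore ω 1 n) :=
      mul_le_mul (by linarith) (by linarith) hq.le (by linarith)
    linarith
  -- The averages of `s` tend to `escapeProb ω 1`, which then appears on both sides and cancels
  -- because it is positive.
  have hces := (hst.cesaro.comp (tendsto_add_atTop_nat 1)).const_mul A
  have hinv : Tendsto (fun L : ℕ => (((L + 1 : ℕ) : ℝ))⁻¹) atTop (nhds 0) :=
    (tendsto_inv_atTop_zero.comp tendsto_natCast_atTop_atTop).comp (tendsto_add_atTop_nat 1)
  have hlim := hinv.add hces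
  rw [zero_add] at hlim
  have hfin : N * escapeProb ω 1 ≤ A * escapeProb ω 1 := by
    refine ge_of_tendsto' hlim fun L => ?_
    have hpos : (0 : ℝ) < ((L + 1 : ℕ) : ℝ) := by positivity
    refine le_of_mul_le_mul_left ?_ hpos
    have := hmain L
    simp only [Function.comp]
    rw [mul_add, mul_inv_cancel₀ hpos.ne', mul_left_comm A, mul_inv_cancel_left₀ hpos.ne']
    linarith
  exact le_of_mul_le_mul_right hfin hq

/-- Positivity passes from a site to its left neighbour; translating `z` by `|z - x|` periods first
places it at or to the right of `x`. -/
theorem escapeProb_pos_of_pos (hω : ∀ x, ω x ∈ Set.Ico (1 / 2 : ℝ) 1) {N : ℕ} (hN1 : 1 ≤ N)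
    (hN : ∀ x : ℤ, ω (x + N) = ω x) {z : ℤ} (hz : 0 < escapeProb ω z) (x : ℤ) :
    0 < escapeProb ω x := by
  have hdown : ∀ k : ℕ, ∀ y : ℤ, y + k = z + (z - x).natAbs * N → 0 < escapeProb ω y := by
    intro k
    induction k with
    | zero =>
      intro y hy
      obtain rfl : y = z + (z - x).natAbs * N := by simpa using hy
      rwa [escapeProb_translate (periodic_mul hN _)]
    | succ k ih =>
      intro y hy
      have := ih (y + 1) (by rw [Nat.cast_succ] at hy; linarith)
      exact (mul_pos (by linarith [(hω y).1]) this).trans_le (mul_escapeProb_succ_le hω y)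
  have h : x ≤ z + (z - x).natAbs * N := by
    have : ((z - x).natAbs : ℤ) * 1 ≤ (z - x).natAbs * N :=
      mul_le_mul_of_nonneg_left (by omega) (by positivity)
    omega
  exact hdown (z + (z - x).natAbs * N - x).toNat x (by omega)

/-- Source of the threshold 2: mean site drift 1 means that `ω / (1 - ω)` has mean 2. -/
theorem sum_siteDrift (hω : ∀ x, ω x ∈ Set.Ico (1 / 2 : ℝ) 1) (N : ℕ) :
    ∑ z ∈ Finset.Icc (1 : ℤ) N, siteDrift ω z =
      ∑ z ∈ Finset.Icc (1 : ℤ) N, ω z / (1 - ω z) - N := by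
  have : ∀ z ∈ Finset.Icc (1 : ℤ) N, siteDrift ω z = ω z / (1 - ω z) - 1 := by
    intro z _
    have : 1 - ω z ≠ 0 := by linarith [(hω z).2]
    rw [siteDrift]; field_simp; ring
  rw [Finset.sum_congr rfl this, Finset.sum_sub_distrib]
  simp

/-- Dichotomy for periodic environments in terms of the mean drift. -/
theorem escapeProb_dichotomy (hω : ∀ x, ω x ∈ Set.Ico (1 / 2 : ℝ) 1) {N : ℕ} (hN1 : 1 ≤ N)
    (hN : ∀ x : ℤ, ω (x + N) = ω x) :
    ((1 / (N : ℝ)) * ∑ x ∈ Finset.Icc (1 : ℤ) N, ω x / (1 - ω x) ≤ 2 →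
      ∀ x, escapeProb ω x = 0) ∧
    (2 < (1 / (N : ℝ)) * ∑ x ∈ Finset.Icc (1 : ℤ) N, ω x / (1 - ω x) →
      ∀ x, 0 < escapeProb ω x) := by
  have hNpos : (0 : ℝ) < N := by exact_mod_cast hN1
  have hI := sum_siteDrift_mul_le hω hN
  have hS := sum_siteDrift hω N
  rw [one_div, ← div_eq_inv_mul, div_le_iff₀ hNpos, lt_div_iff₀ hNpos]
  constructor
  · intro h x
    by_contra hx
    have hpos := escapeProb_pos_of_pos hω hN1 hN ((escapeProb_nonneg hω x).lt_of_ne' hx)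
    have hII := le_sum_siteDrift_mul hω hN1 hN (hpos 1)
    have hle : ∀ z ∈ Finset.Icc (1 : ℤ) N,
        siteDrift ω z * (1 - escapeProb ω z) ≤ siteDrift ω z := fun z _ =>
      mul_le_of_le_one_right (siteDrift_nonneg hω z) (by linarith [hpos z])
    -- Covers the critical case too: the sums are squeezed to equality, so each site drift vanishes
    -- since the escape probabilities are positive, contradicting a total of at least `N`.
    have heq := (Finset.sum_eq_sum_iff_of_le hle).1
      (le_antisymm (Finset.sum_le_sum hle) (by linarith))
    have hzero : ∀ z ∈ Finset.Icc (1 : ℤ) N, siteDrift ω z * (1 - escapeProb ω z) = 0 := by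
      intro z hz
      have h₁ : siteDrift ω z * escapeProb ω z = 0 := by linarith [heq z hz]
      rw [(mul_eq_zero.1 h₁).resolve_right (hpos z).ne', zero_mul]
    rw [Finset.sum_eq_zero hzero] at hII
    linarith
  · intro h
    by_contra! hx
    obtain ⟨x, hx⟩ := hx
    have hall : ∀ z, escapeProb ω z = 0 := by
      intro z
      by_contra hz
      exact hx.not_gt
        (escapeProb_pos_of_pos hω hN1 hN ((escapeProb_nonneg hω z).lt_of_ne' hz) x)
    simp only [hall, sub_zero, mul_one] at hI
    linarith

/-- The escape probability in a homogeneous environment. -/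
theorem escapeProb_of_const {p : ℝ} (hp : p ∈ Set.Ioo (1 / 2 : ℝ) 1) (hωp : ∀ x, ω x = p)
    (h : 2 / 3 < p) : escapeProb ω 1 = (3 * p - 2) / (2 * p - 1) := by
  have hω : ∀ x, ω x ∈ Set.Ico (1 / 2 : ℝ) 1 := fun x => by rw [hωp]; exact ⟨hp.1.le, hp.2⟩
  have hN : ∀ x : ℤ, ω (x + (1 : ℕ)) = ω x := fun x => by rw [hωp, hωp]
  have h₁ : 0 < 1 - p := by linarith [hp.2]
  have h₂ : 0 < 2 * p - 1 := by linarith [hp.1]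
  have hpos : 0 < escapeProb ω 1 := by
    refine (escapeProb_dichotomy hω le_rfl hN).2 ?_ 1
    simp only [Nat.cast_one, Finset.Icc_self, Finset.sum_singleton, hωp]
    rw [div_one, one_mul, lt_div_iff₀ h₁]
    linarith
  -- With period 1 the two bounds become one equation for the escape probability.
  have hI := sum_siteDrift_mul_le hω hN
  have hII := le_sum_siteDrift_mul hω le_rfl hN hpos
  simp only [Nat.cast_one, Finset.Icc_self, Finset.sum_singleton] at hI hII
  have e := le_antisymm hI hII
  rw [siteDrift, hωp, div_mul_eq_mul_div, div_eq_one_iff_eq h₁.ne'] at e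
  rw [eq_div_iff h₂.ne']
  linarith

end

/-! ### Nearest-neighbour paths -/

/-- A path on the integers with steps `±1`. -/
def IsNearestNeighbor (h : ℕ → ℤ) : Prop := ∀ k, h (k + 1) = h k + 1 ∨ h (k + 1) = h k - 1

theorem leftSites_zero (h : ℕ → ℤ) : leftSites h 0 = ∅ := by
  ext; simp [leftSites]

theorem leftSites_succ_of_right {h : ℕ → ℤ} {k : ℕ} (hk : h (k + 1) = h k + 1) :
    leftSites h (k + 1) = leftSites h k := by
  ext x
  simp only [leftSites, Set.mem_ofPred_eq]
  constructor
  · rintro ⟨m, hm, h₁, h₂⟩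
    rcases (Nat.lt_succ_iff.1 hm).eq_or_lt with rfl | hm
    · omega
    · exact ⟨m, hm, h₁, h₂⟩
  · rintro ⟨m, hm, h₁⟩
    exact ⟨m, by omega, h₁⟩

theorem leftSites_succ_of_left {h : ℕ → ℤ} {k : ℕ} (hk : h (k + 1) = h k - 1) :
    leftSites h (k + 1) = insert (h k) (leftSites h k) := by
  ext x
  simp only [leftSites, Set.mem_ofPred_eq, Set.mem_insert_iff]
  constructor
  · rintro ⟨m, hm, h₁, h₂⟩
    rcases (Nat.lt_succ_iff.1 hm).eq_or_lt with rfl | hm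
    · exact Or.inl h₁.symm
    · exact Or.inr ⟨m, hm, h₁, h₂⟩
  · rintro (rfl | ⟨m, hm, h₁⟩)
    · exact ⟨k, by omega, rfl, hk⟩
    · exact ⟨m, by omega, h₁⟩

theorem leftSites_congr {h h' : ℕ → ℤ} {k : ℕ} (e : ∀ j ≤ k, h j = h' j) :
    leftSites h k = leftSites h' k := by
  ext x
  simp only [leftSites, Set.mem_ofPred_eq]
  refine exists_congr fun m => and_congr_right fun hm => ?_
  rw [e m hm.le, e (m + 1) hm]

theorem rightProb_eq (ω : ℤ → ℝ) (h : ℕ → ℤ) (n : ℕ) :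
    rightProb ω h n = jumpProb ω (h n) (leftSites h n) := by
  by_cases hn : ∃ m : ℕ, m < n ∧ h m = h n ∧ h (m + 1) = h m - 1
  · rw [rightProb, jumpProb, if_pos hn, if_pos (by exact hn)]
  · rw [rightProb, jumpProb, if_neg hn, if_neg (by exact hn)]

theorem IsNearestNeighbor.good {h : ℕ → ℤ} (hh : IsNearestNeighbor h) (k : ℕ) :
    Good (h k) (leftSites h k) := by
  induction k with
  | zero => rw [leftSites_zero]; exact good_empty _
  | succ k ih =>
    rcases hh k with hk | hk
    · rw [leftSites_succ_of_right hk, hk]; exact ih.right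
    · rw [leftSites_succ_of_left hk, hk]; exact ih.left

theorem IsNearestNeighbor.le_add {h : ℕ → ℤ} (hh : IsNearestNeighbor h) (k : ℕ) :
    h k ≤ h 0 + k := by
  induction k with
  | zero => simp
  | succ k ih => rcases hh k with hk | hk <;> push_cast <;> omega

theorem IsNearestNeighbor.le_of_mem_leftSites {h : ℕ → ℤ} (hh : IsNearestNeighbor h) {k : ℕ}
    {x : ℤ} (hx : x ∈ leftSites h k) : x ≤ h 0 + k := by
  obtain ⟨m, hm, rfl, -⟩ := hx
  have := hh.le_add m
  omega

/-- A nearest-neighbour path that goes from `[n, ∞)` to below `n` makes a left jump from `n`. -/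
theorem IsNearestNeighbor.exists_left_jump {h : ℕ → ℤ} (hh : IsNearestNeighbor h) {n : ℤ}
    {s t : ℕ} (hst : s ≤ t) (hs : n ≤ h s) (ht : h t < n) :
    ∃ j, s ≤ j ∧ h j = n ∧ h (j + 1) = h j - 1 := by
  induction t, hst using Nat.le_induction with
  | base => omega
  | succ t hst ih =>
    by_cases h' : h t < n
    · exact ih h'
    · exact ⟨t, hst, by rcases hh t with hk | hk <;> omega, by rcases hh t with hk | hk <;> omega⟩

theorem IsNearestNeighbor.frequently_eq {h : ℕ → ℤ} (hh : IsNearestNeighbor h)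
    (hup : ∀ n : ℤ, ∃ k, n ≤ h k) (hdown : ∀ n : ℤ, ∃ k, h k ≤ n) (x : ℤ) :
    ∃ᶠ k in atTop, h k = x := by
  rw [frequently_atTop]
  intro K
  have bound : ∀ K : ℕ, ∃ M : ℤ, ∀ j ≤ K, |h j| ≤ M := fun K =>
    ⟨∑ j ∈ Finset.range (K + 1), |h j|, fun j hj =>
      Finset.single_le_sum (f := fun j => |h j|) (fun i _ => abs_nonneg _)
        (Finset.mem_range.2 (by omega))⟩
  obtain ⟨M, hM⟩ := bound K
  -- Time `s` exceeds every value up to time `K`, and `t` lies below every value up to `s`; hence `K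
  -- ≤ s ≤ t`, and the descent in between passes through `x`.
  obtain ⟨s, hs⟩ := hup (max (M + 1) x)
  obtain ⟨M', hM'⟩ := bound s
  obtain ⟨t, ht⟩ := hdown (min (-M' - 1) (x - 1))
  have hKs : K ≤ s := by
    by_contra hlt
    have := abs_le.1 (hM s (by omega))
    omega
  have hst : s ≤ t := by
    by_contra hlt
    have := abs_le.1 (hM' t (by omega))
    omega
  obtain ⟨j, hj, hjx, -⟩ := hh.exists_left_jump hst (n := x) (by omega) (by omega)
  exact ⟨j, by omega, hjx⟩

/-! ### Conditional expectation -/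

/-- The known factor `G` is pulled out of the conditional expectation, so the indicator may be
replaced by its conditional probability. -/
theorem setIntegral_indicator_mul_of_condExp {Ω : Type*} {m m₀ : MeasurableSpace Ω} (hm : m ≤ m₀)
    {μ : Measure Ω} [IsProbabilityMeasure μ] {R B : Set Ω} (hR : MeasurableSet R)
    (hB : MeasurableSet[m] B) {w G : Ω → ℝ} (hw : μ⟦R | m⟧ =ᵐ[μ] w)
    (hG : Measurable[m] G) {C : ℝ} (hGC : ∀ a, |G a| ≤ C) :
    IntegrableOn (fun a => R.indicator (fun _ => (1 : ℝ)) a * G a) B μ ∧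
      IntegrableOn (fun a => w a * G a) B μ ∧
      ∫ a in B, R.indicator (fun _ => (1 : ℝ)) a * G a ∂μ = ∫ a in B, w a * G a ∂μ := by
  have hR1 : Integrable (R.indicator fun _ => (1 : ℝ)) μ := (integrable_const 1).indicator hR
  have hG' : AEStronglyMeasurable G μ := (hG.mono hm le_rfl).aestronglyMeasurable
  have hRG : Integrable (R.indicator (fun _ => (1 : ℝ)) * G) μ :=
    hR1.mul_bdd (c := C) hG' (Eventually.of_forall hGC)
  have e := condExp_mul_of_stronglyMeasurable_right hG.stronglyMeasurable hRG hR1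
  have e' : μ[R.indicator (fun _ => (1 : ℝ)) * G | m] =ᵐ[μ] fun a => w a * G a := by
    filter_upwards [e, hw] with a h₁ h₂
    rw [h₁, Pi.mul_apply, h₂]
  refine ⟨hRG.integrableOn, (integrable_condExp.congr e').integrableOn, ?_⟩
  rw [← setIntegral_congr_ae (hm _ hB) (e'.mono fun a h _ => h), setIntegral_condExp hm hRG hB]
  rfl

/-- The hypothesis bounds all conditional probabilities of `A` by `c < 1`, but by Lévy's upward
theorem they converge to 1 almost everywhere on `A`. -/
theorem measure_eq_zero_of_forall_inter_le {Ω : Type*} {m₀ : MeasurableSpace Ω} {μ : Measure Ω}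
    [IsProbabilityMeasure μ] (ℱ : Filtration ℕ m₀) {A : Set Ω} (hA : MeasurableSet[⨆ n, ℱ n] A)
    {c : ℝ} (hc : c < 1)
    (h : ∀ n B, MeasurableSet[ℱ n] B → μ.real (A ∩ B) ≤ c * μ.real B) : μ A = 0 := by
  have hA' : MeasurableSet A := (iSup_le fun n => ℱ.le n) _ hA
  have hint : Integrable (A.indicator fun _ => (1 : ℝ)) μ := (integrable_const 1).indicator hA'
  have hle : ∀ n, ∀ᵐ a ∂μ, (μ[A.indicator fun _ => (1 : ℝ) | ℱ n]) a ≤ c := by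
    intro n
    refine ae_le_of_ae_le_trim (hm := ℱ.le n) (ae_le_of_forall_setIntegral_le
      (integrable_condExp.trim (ℱ.le n) stronglyMeasurable_condExp) (integrable_const c)
      fun B hB _ => ?_)
    rw [← setIntegral_trim (ℱ.le n) stronglyMeasurable_condExp hB,
      ← setIntegral_trim (ℱ.le n) stronglyMeasurable_const hB, setIntegral_condExp _ hint hB,
      setIntegral_indicator hA']
    have := h n B hB
    rw [Set.inter_comm] at this
    simpa [mul_comm] using this
  have hlim := hint.tendsto_ae_condExp (ℱ := ℱ) (stronglyMeasurable_const.indicator hA)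
  rw [measure_eq_zero_iff_ae_notMem]
  filter_upwards [hlim, ae_all_iff.2 hle] with a h₁ h₂ ha
  have := le_of_tendsto' h₁ h₂
  rw [Set.indicator_of_mem ha] at this
  linarith

/-! ### The Markov property -/

variable {Ω : Type*} [mΩ : MeasurableSpace Ω] {ω : ℤ → ℝ} {P : ℤ → Measure Ω} {X : ℕ → Ω → ℤ}

/-- The natural filtration of the walk. -/
def IsCookieWalk.filtration (hX : IsCookieWalk ω P X) :
    Filtration ℕ mΩ :=
  Filtration.natural X fun k => (hX.measurable k).stronglyMeasurable

theorem IsCookieWalk.measurable_apply (hX : IsCookieWalk ω P X) {j k : ℕ} (hjk : j ≤ k) :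
    Measurable[hX.filtration k] (X j) :=
  ((Filtration.stronglyAdapted_natural fun k => (hX.measurable k).stronglyMeasurable) j).measurable.mono
    (hX.filtration.mono hjk) le_rfl

/-- Such a function factors through a finite tuple of integers, a countable discrete space on which
every function is measurable. -/
theorem IsCookieWalk.measurable_of_congr (hX : IsCookieWalk ω P X) {β : Type*}
    [MeasurableSpace β] (k : ℕ) (F : (ℕ → ℤ) → β)
    (hF : ∀ h h' : ℕ → ℤ, (∀ j ≤ k, h j = h' j) → F h = F h') :
    Measurable[hX.filtration k] fun a => F fun j => X j a := by
  have h₁ : Measurable[hX.filtration k] fun a => fun j : Finset.Iic k => X j a :=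
    @measurable_pi_lambda _ _ _ (hX.filtration k) _ _ fun j =>
      hX.measurable_apply (Finset.mem_Iic.1 j.2)
  have h₂ : Measurable fun p : Finset.Iic k → ℤ =>
      F fun j => p ⟨min j k, Finset.mem_Iic.2 (min_le_right _ _)⟩ := Measurable.of_discrete
  have e : (fun a => F fun j => X j a) = (fun p : Finset.Iic k → ℤ =>
      F fun j => p ⟨min j k, Finset.mem_Iic.2 (min_le_right _ _)⟩) ∘
        fun a => fun j : Finset.Iic k => X j a := by
    funext a
    refine hF _ _ fun j hj => ?_
    simp [min_eq_left hj]
  rw [e]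
  exact h₂.comp h₁

theorem IsCookieWalk.measurable_state (hX : IsCookieWalk ω P X) (k : ℕ)
    (f : ℤ → Set ℤ → ℝ) :
    Measurable[hX.filtration k] fun a => f (X k a) (leftSites (fun j => X j a) k) :=
  hX.measurable_of_congr k (fun h => f (h k) (leftSites h k)) fun h h' e => by
    simp only [leftSites_congr e, e k le_rfl]

theorem IsCookieWalk.integrable_state (hX : IsCookieWalk ω P X) (y : ℤ) (k : ℕ)
    {f : ℤ → Set ℤ → ℝ} {C : ℝ} (hf : ∀ x S, |f x S| ≤ C) :
    Integrable (fun a => f (X k a) (leftSites (fun j => X j a) k)) (P y) := by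
  have := hX.isProbabilityMeasure y
  exact Integrable.of_bound
    ((hX.measurable_state k f).mono (hX.filtration.le k) le_rfl).aestronglyMeasurable C
    (Eventually.of_forall fun a => hf _ _)

/-- The conditional probabilities of the two disjoint jumps add up to 1, so their union is almost
sure. -/
theorem IsCookieWalk.ae_isNearestNeighbor (hX : IsCookieWalk ω P X) (y : ℤ) :
    ∀ᵐ a ∂(P y), IsNearestNeighbor fun k => X k a := by
  have := hX.isProbabilityMeasure y
  refine ae_all_iff.2 fun k => ?_
  have hR : MeasurableSet {a | X (k + 1) a = X k a + 1} :=
    measurableSet_eq_fun (hX.measurable _) ((hX.measurable _).add_const 1)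
  have hL : MeasurableSet {a | X (k + 1) a = X k a - 1} :=
    measurableSet_eq_fun (hX.measurable _) ((hX.measurable _).sub_const 1)
  have hdisj : Disjoint {a | X (k + 1) a = X k a + 1} {a | X (k + 1) a = X k a - 1} := by
    rw [Set.disjoint_left]
    intro a h₁ h₂
    simp only [Set.mem_ofPred_eq] at h₁ h₂
    omega
  have hr : (P y)⟦{a | X (k + 1) a = X k a + 1} | hX.filtration k⟧ =ᵐ[P y]
      fun a => rightProb ω (fun k => X k a) k := hX.right y k
  have hl : (P y)⟦{a | X (k + 1) a = X k a - 1} | hX.filtration k⟧ =ᵐ[P y]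
      fun a => 1 - rightProb ω (fun k => X k a) k := hX.left y k
  have e₁ : (P y).real {a | X (k + 1) a = X k a + 1} =
      ∫ a, rightProb ω (fun k => X k a) k ∂(P y) := by
    rw [← integral_congr_ae hr, integral_condExp (hX.filtration.le k),
      integral_indicator_const _ hR, smul_eq_mul, mul_one]
  have e₂ : (P y).real {a | X (k + 1) a = X k a - 1} =
      ∫ a, (1 - rightProb ω (fun k => X k a) k) ∂(P y) := by
    rw [← integral_congr_ae hl, integral_condExp (hX.filtration.le k),
      integral_indicator_const _ hL, smul_eq_mul, mul_one]
  have hint : Integrable (fun a => rightProb ω (fun k => X k a) k) (P y) :=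
    integrable_condExp.congr hr
  rw [integral_sub (integrable_const 1) hint, ← e₁] at e₂
  have hu : (P y).real ({a | X (k + 1) a = X k a + 1} ∪ {a | X (k + 1) a = X k a - 1}) = 1 := by
    rw [measureReal_union hdisj hL, e₂]; simp
  have := (prob_compl_eq_zero_iff (hR.union hL)).2
    (by rwa [measureReal_def, ENNReal.toReal_eq_one_iff] at hu)
  rw [ae_iff]
  convert this using 2
  ext a
  simp

/-- The one-step Markov property of the chain of states. -/
theorem IsCookieWalk.setIntegral_succ (hX : IsCookieWalk ω P X) (y : ℤ) (k : ℕ)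
    {f : ℤ → Set ℤ → ℝ} {C : ℝ} (hf : ∀ x S, |f x S| ≤ C) {B : Set Ω}
    (hB : MeasurableSet[hX.filtration k] B) :
    ∫ a in B, f (X (k + 1) a) (leftSites (fun j => X j a) (k + 1)) ∂(P y) =
      ∫ a in B, stepAvg ω f (X k a) (leftSites (fun j => X j a) k) ∂(P y) := by
  have := hX.isProbabilityMeasure y
  have hm := hX.filtration.le k
  have hR : MeasurableSet {a | X (k + 1) a = X k a + 1} :=
    measurableSet_eq_fun (hX.measurable _) ((hX.measurable _).add_const 1)
  have hL : MeasurableSet {a | X (k + 1) a = X k a - 1} :=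
    measurableSet_eq_fun (hX.measurable _) ((hX.measurable _).sub_const 1)
  obtain ⟨i₁, i₂, e₁⟩ := setIntegral_indicator_mul_of_condExp hm hR hB (hX.right y k)
    (hX.measurable_state k fun x S => f (x + 1) S) (C := C) fun a => hf _ _
  obtain ⟨j₁, j₂, e₂⟩ := setIntegral_indicator_mul_of_condExp hm hL hB (hX.left y k)
    (hX.measurable_state k fun x S => f (x - 1) (insert x S)) (C := C) fun a => hf _ _
  have key : ∀ᵐ a ∂(P y), f (X (k + 1) a) (leftSites (fun j => X j a) (k + 1)) =
      {a | X (k + 1) a = X k a + 1}.indicator (fun _ => (1 : ℝ)) a *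
          f (X k a + 1) (leftSites (fun j => X j a) k) +
        {a | X (k + 1) a = X k a - 1}.indicator (fun _ => (1 : ℝ)) a *
          f (X k a - 1) (insert (X k a) (leftSites (fun j => X j a) k)) := by
    filter_upwards [hX.ae_isNearestNeighbor y] with a ha
    rcases ha k with hk | hk
    · have hk' : X (k + 1) a ≠ X k a - 1 := by simp only at hk; omega
      rw [leftSites_succ_of_right hk, Set.indicator_of_mem (by exact hk),
        Set.indicator_of_notMem (by exact hk')]
      simp only at hk
      rw [hk]; ring
    · have hk' : X (k + 1) a ≠ X k a + 1 := by simp only at hk; omega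
      rw [leftSites_succ_of_left hk, Set.indicator_of_notMem (by exact hk'),
        Set.indicator_of_mem (by exact hk)]
      simp only at hk
      rw [hk]; ring
  rw [setIntegral_congr_ae (hm _ hB) (key.mono fun a h _ => h), integral_add i₁ j₁, e₁, e₂,
    ← integral_add i₂ j₂]
  simp only [rightProb_eq]
  rfl

/-! ### Hitting probabilities -/

theorem IsCookieWalk.measurableSet_of_congr (hX : IsCookieWalk ω P X) (k : ℕ)
    (p : (ℕ → ℤ) → Prop) (hp : ∀ h h' : ℕ → ℤ, (∀ j ≤ k, h j = h' j) → p h = p h') :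
    MeasurableSet[hX.filtration k] {a | p fun j => X j a} :=
  (@measurableSet_setOfPred _ (hX.filtration k) _).2 (hX.measurable_of_congr k p hp)

/-- Induction on the remaining number of steps `m`, for all `k` at once: the paths in `A` at time
`k` are split off, and the Markov property moves the rest to time `k + 1`. -/
theorem IsCookieWalk.measureReal_exists_mem (hX : IsCookieWalk ω P X)
    (hω : ∀ x, ω x ∈ Set.Ico (1 / 2 : ℝ) 1) (y : ℤ) (A : Set ℤ) (m : ℕ) : ∀ k : ℕ,
    (P y).real {a | ∃ j < k + m + 1, X j a ∈ A} = (P y).real {a | ∃ j < k, X j a ∈ A} +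
      ∫ a in {a | ∀ j < k, X j a ∉ A},
        hitProb ω A ∅ m (X k a) (leftSites (fun j => X j a) k) ∂(P y) := by
  have := hX.isProbabilityMeasure y
  have hA : ∀ k, MeasurableSet {a | X k a ∈ A} := fun k => hX.measurable k (MeasurableSet.of_discrete)
  have hE : ∀ k : ℕ, MeasurableSet[hX.filtration k] {a | ∀ j < k + 1, X j a ∉ A} := fun k =>
    hX.measurableSet_of_congr k (fun h => ∀ j < k + 1, h j ∉ A) fun h h' e => by
      refine propext (forall₂_congr fun j hj => ?_)
      rw [e j (by omega)]
  have hE' : ∀ k : ℕ, MeasurableSet {a | ∀ j < k, X j a ∉ A} := fun k => by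
    cases k with
    | zero => simp
    | succ k => exact hX.filtration.le k _ (hE k)
  have hsucc : ∀ k, (P y).real {a | ∃ j < k + 1, X j a ∈ A} =
      (P y).real {a | ∃ j < k, X j a ∈ A} +
        (P y).real ({a | ∀ j < k, X j a ∉ A} ∩ {a | X k a ∈ A}) := by
    intro k
    rw [← measureReal_union _ ((hE' k).inter (hA k))]
    · congr 1
      ext a
      simp only [Set.mem_ofPred_eq, Set.mem_union, Set.mem_inter_iff, Nat.lt_succ_iff_lt_or_eq]
      constructor
      · rintro ⟨j, hj | rfl, hjA⟩
        · exact Or.inl ⟨j, hj, hjA⟩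
        · by_cases h : ∃ i < j, X i a ∈ A
          · exact Or.inl h
          · push Not at h
            exact Or.inr ⟨h, hjA⟩
      · rintro (⟨j, hj, hjA⟩ | ⟨-, h⟩)
        · exact ⟨j, Or.inl hj, hjA⟩
        · exact ⟨k, Or.inr rfl, h⟩
    · rw [Set.disjoint_left]
      rintro a ⟨j, hj, hjA⟩ ⟨h, -⟩
      exact h j hj hjA
  have hbd : ∀ m x S, |hitProb ω A ∅ m x S| ≤ 1 := fun m x S => by
    have := hitProb_mem_Icc hω A ∅ m x S
    exact abs_le.2 ⟨by linarith [this.1], this.2⟩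
  have hsplit : ∀ (m k : ℕ), ∫ a in {a | ∀ j < k, X j a ∉ A},
      hitProb ω A ∅ m (X k a) (leftSites (fun j => X j a) k) ∂(P y) =
      (P y).real ({a | ∀ j < k, X j a ∉ A} ∩ {a | X k a ∈ A}) +
      ∫ a in {a | ∀ j < k + 1, X j a ∉ A},
        hitProb ω A ∅ m (X k a) (leftSites (fun j => X j a) k) ∂(P y) := by
    intro m k
    rw [← integral_inter_add_sdiff (hA k) (hX.integrable_state y k (hbd m)).integrableOn]
    congr 1
    · rw [setIntegral_congr_fun (g := fun _ => (1 : ℝ)) ((hE' k).inter (hA k))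
        fun a ha => hitProb_of_mem (A := A) (B := ∅) (by exact ha.2) m _]
      simp
    · congr 2
      ext a
      simp only [Set.mem_sdiff, Set.mem_ofPred_eq, Nat.lt_succ_iff_lt_or_eq]
      constructor
      · rintro ⟨h₁, h₂⟩ j (hj | rfl)
        · exact h₁ j hj
        · exact h₂
      · exact fun h => ⟨fun j hj => h j (Or.inl hj), h k (Or.inr rfl)⟩
  induction m with
  | zero =>
    intro k
    rw [add_zero, hsucc, hsplit 0 k,
      setIntegral_congr_fun (g := fun _ => (0 : ℝ)) (hE' (k + 1)) fun a ha => ?_]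
    · simp
    · simp [hitProb, ha k (by omega)]
  | succ m ih =>
    intro k
    rw [show k + (m + 1) + 1 = k + 1 + m + 1 by ring, ih (k + 1), hsucc, hsplit (m + 1) k,
      hX.setIntegral_succ y k (hbd m) (hE k), add_assoc]
    congr 2
    refine setIntegral_congr_fun (hE' (k + 1)) fun a ha => ?_
    simp [hitProb, ha k (by omega)]

/-- The probability that the walk started at `y` ever visits `A`. -/
theorem IsCookieWalk.measureReal_exists (hX : IsCookieWalk ω P X)
    (hω : ∀ x, ω x ∈ Set.Ico (1 / 2 : ℝ) 1) (y : ℤ) (A : Set ℤ) :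
    (P y).real {a | ∃ j, X j a ∈ A} = hitLim ω A ∅ y ∅ := by
  have := hX.isProbabilityMeasure y
  have h₁ : ∀ m : ℕ, (P y).real {a | ∃ j < m + 1, X j a ∈ A} = hitProb ω A ∅ m y ∅ := by
    intro m
    have h := hX.measureReal_exists_mem hω y A m 0
    have e : ∫ a, hitProb ω A ∅ m (X 0 a) (leftSites (fun j => X j a) 0) ∂(P y) =
        ∫ _, hitProb ω A ∅ m y ∅ ∂(P y) := by
      refine integral_congr_ae ?_
      filter_upwards [hX.start y] with a ha
      rw [leftSites_zero, ha]
    simp only [zero_add, not_lt_zero, false_and, exists_false, Set.ofPred_false, measureReal_empty,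
      IsEmpty.forall_iff, implies_true, Set.ofPred_true, Measure.restrict_univ] at h
    rw [h, e]
    simp
  have hmono : Monotone fun m : ℕ => {a | ∃ j < m + 1, X j a ∈ A} := by
    rintro m m' hm a ⟨j, hj, hjA⟩
    exact ⟨j, by omega, hjA⟩
  have hU : ⋃ m : ℕ, {a | ∃ j < m + 1, X j a ∈ A} = {a | ∃ j, X j a ∈ A} := by
    ext a
    simp only [Set.mem_iUnion, Set.mem_ofPred_eq]
    exact ⟨fun ⟨_, j, _, h⟩ => ⟨j, h⟩, fun ⟨j, h⟩ => ⟨j, j, by omega, h⟩⟩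
  have h₂ := tendsto_measure_iUnion_atTop (μ := P y) hmono
  rw [hU] at h₂
  have h₃ := (ENNReal.tendsto_toReal (measure_ne_top (P y) _)).comp h₂
  refine tendsto_nhds_unique (h₃.congr fun m => ?_) (tendsto_hitProb hω A ∅ y ∅)
  exact h₁ m

theorem IsCookieWalk.ae_exists_of_hitLim_eq_one (hX : IsCookieWalk ω P X)
    (hω : ∀ x, ω x ∈ Set.Ico (1 / 2 : ℝ) 1) {y : ℤ} {A : Set ℤ} (h : hitLim ω A ∅ y ∅ = 1) :
    ∀ᵐ a ∂(P y), ∃ j, X j a ∈ A := by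
  have := hX.isProbabilityMeasure y
  have h' := hX.measureReal_exists hω y A
  rw [h, measureReal_def, ENNReal.toReal_eq_one_iff] at h'
  have hmeas : MeasurableSet {a | ∃ j, X j a ∈ A} := by
    rw [Set.ofPred_exists]
    exact MeasurableSet.iUnion fun j => hX.measurable j MeasurableSet.of_discrete
  exact (mem_ae_iff_prob_eq_one hmeas).2 h'

theorem IsCookieWalk.ae_exists_ge (hX : IsCookieWalk ω P X)
    (hω : ∀ x, ω x ∈ Set.Ico (1 / 2 : ℝ) 1) (y : ℤ) :
    ∀ᵐ a ∂(P y), ∀ n : ℤ, ∃ j, n ≤ X j a :=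
  ae_all_iff.2 fun n => hX.ae_exists_of_hitLim_eq_one hω (hitLim_Ici_eq_one hω n y)

theorem IsCookieWalk.recurrent (hX : IsCookieWalk ω P X)
    (hω : ∀ x, ω x ∈ Set.Ico (1 / 2 : ℝ) 1) (hq : ∀ x, escapeProb ω x = 0) : Recurrent P X := by
  intro x y
  have := hX.isProbabilityMeasure y
  have hdown : ∀ᵐ a ∂(P y), ∀ n : ℤ, ∃ j, X j a ≤ n :=
    ae_all_iff.2 fun n => hX.ae_exists_of_hitLim_eq_one hω (hitLim_Iic_eq_one hω hq n y)
  refine (measure_congr (eventuallyEq_univ.2 ?_)).trans measure_univ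
  filter_upwards [hX.ae_exists_ge hω y, hdown, hX.ae_isNearestNeighbor y] with a h₁ h₂ h₃
  exact h₃.frequently_eq h₁ h₂ x

theorem Transient.not_recurrent (hT : Transient P X) :
    ¬ Recurrent P X := fun hR => by
  have := (hR 0 0).symm.trans (hT 0 0)
  exact one_ne_zero this

/-- From 1, a nearest-neighbour path cannot enter `(-∞, 0]` without visiting 0. -/
theorem IsCookieWalk.measureReal_hitTime_eq_top (hX : IsCookieWalk ω P X)
    (hω : ∀ x, ω x ∈ Set.Ico (1 / 2 : ℝ) 1) :
    (P 1).real {a | hitTime X 0 a = ⊤} = escapeProb ω 1 := by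
  have := hX.isProbabilityMeasure 1
  have hmeas : MeasurableSet {a | ∃ j, X j a ∈ Set.Iic (0 : ℤ)} := by
    rw [Set.ofPred_exists]
    exact MeasurableSet.iUnion fun j => hX.measurable j MeasurableSet.of_discrete
  have e : ({a | hitTime X 0 a = ⊤} : Set Ω) =ᵐ[P 1]
      ({a | ∃ j, X j a ∈ Set.Iic (0 : ℤ)}ᶜ : Set Ω) := by
    refine eventuallyEq_set.2 ?_
    filter_upwards [hX.ae_isNearestNeighbor 1, hX.start 1] with a h₁ h₂
    change hittingAfter X {0} 0 a = ⊤ ↔ ¬ ∃ j, X j a ∈ Set.Iic (0 : ℤ)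
    rw [hittingAfter_eq_top_iff]
    constructor
    · rintro h ⟨j, hj⟩
      rcases (Set.mem_Iic.1 hj).eq_or_lt with h0 | h0
      · exact h j j.zero_le h0
      · obtain ⟨i, -, hi, -⟩ := h₁.exists_left_jump (n := 0) j.zero_le
          (by simp only [h₂]; omega) h0
        exact h i i.zero_le hi
    · rintro h j - hj
      exact h ⟨j, (Set.mem_singleton_iff.1 hj).le⟩
  rw [measureReal_congr e, probReal_compl_eq_one_sub hmeas, hX.measureReal_exists hω]
  rfl

/-! ### Transience -/

open Classical in
/-- The conditional probability, given the current state `(w, S)`, that a left jump from `n` ever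
occurs, for a walk that reaches `n` almost surely. -/
noncomputable def leftJumpLim (ω : ℤ → ℝ) (n w : ℤ) (S : Set ℤ) : ℝ :=
  if n ∈ S then 1 else if n ≤ w then hitLim ω (Set.Iic (n - 1)) ∅ w S else 1 - escapeProb ω n

theorem leftJumpLim_mem_Icc (hω : ∀ x, ω x ∈ Set.Ico (1 / 2 : ℝ) 1) (n w : ℤ) (S : Set ℤ) :
    leftJumpLim ω n w S ∈ Set.Icc (0 : ℝ) 1 := by
  unfold leftJumpLim
  split_ifs
  · simp
  · exact ⟨hitLim_nonneg hω _ _ _ _, hitLim_le_one hω _ _ _ _⟩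
  · exact ⟨by linarith [escapeProb_le_one hω n], by linarith [escapeProb_nonneg hω n]⟩

theorem leftJumpLim_eq_stepAvg (hω : ∀ x, ω x ∈ Set.Ico (1 / 2 : ℝ) 1) {n w : ℤ}
    {S : Set ℤ} (hG : Good w S) :
    leftJumpLim ω n w S = stepAvg ω (leftJumpLim ω n) w S := by
  by_cases hnS : n ∈ S
  · have h : ∀ v (T : Set ℤ), n ∈ T → leftJumpLim ω n v T = 1 := fun v T hT => by
      simp [leftJumpLim, hT]
    rw [stepAvg, h _ _ hnS, h _ _ hnS, h _ _ (Set.mem_insert_of_mem _ hnS)]; ring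
  have hge : ∀ v (T : Set ℤ), n ∉ T → n ≤ v →
      leftJumpLim ω n v T = hitLim ω (Set.Iic (n - 1)) ∅ v T := fun v T hT hv => by
    simp [leftJumpLim, hT, hv]
  have hlt : ∀ v (T : Set ℤ), n ∉ T → v < n → leftJumpLim ω n v T = 1 - escapeProb ω n :=
    fun v T hT hv => by simp [leftJumpLim, hT, hv]
  rcases lt_trichotomy n w with hn | rfl | hn
  · have hn' : n ∉ insert w S := by simp [hn.ne, hnS]
    rw [stepAvg, hge _ _ hnS hn.le, hge _ _ hnS (by omega), hge _ _ hn' (by omega),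
      hitLim_eq_stepAvg hω (by simpa using hn.le) (by simp), stepAvg]
  · have h1 : leftJumpLim ω n (n - 1) (insert n S) = 1 := by simp [leftJumpLim]
    rw [stepAvg, hge _ _ hnS le_rfl, hge _ _ hnS (by omega), h1,
      hitLim_eq_stepAvg hω (by simp) (by simp), stepAvg, hitLim_of_mem (x := n - 1) (by simp)]
  · have hn' : n ∉ insert w S := by simp [hn.ne', hnS]
    have key : leftJumpLim ω n (w + 1) S = 1 - escapeProb ω n := by
      rcases (show w + 1 ≤ n from hn).eq_or_lt with rfl | h
      · rw [hge _ _ hnS le_rfl, escapeProb, sub_sub_cancel]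
        exact hitLim_congr fun u hu => by
          simp [hG.not_mem hn hnS (show w + 1 ≤ u by omega)]
      · exact hlt _ _ hnS h
    rw [stepAvg, key, hlt _ _ hnS hn, hlt _ _ hn' (by omega)]; ring

/-- By time `k` the walk has not yet reached `n`, so the martingale `leftJumpLim` still equals `1 -
escapeProb ω n`. Its later expectations over `B` are the same, and it dominates the indicator that
the jump has occurred. -/
theorem IsCookieWalk.measureReal_inter_le (hX : IsCookieWalk ω P X)
    (hω : ∀ x, ω x ∈ Set.Ico (1 / 2 : ℝ) 1) (y : ℤ) {k : ℕ} {n : ℤ} (hn : y + k < n) {B : Set Ω}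
    (hB : MeasurableSet[hX.filtration k] B) :
    (P y).real ({a | ∃ m, n ∈ leftSites (fun j => X j a) m} ∩ B) ≤
      (1 - escapeProb ω n) * (P y).real B := by
  have := hX.isProbabilityMeasure y
  have hbd : ∀ x S, |leftJumpLim ω n x S| ≤ 1 := fun x S => by
    have := leftJumpLim_mem_Icc hω n x S
    exact abs_le.2 ⟨by linarith [this.1], this.2⟩
  have hB' := hX.filtration.le k _ hB
  have hstep : ∀ m : ℕ, ∫ a in B, leftJumpLim ω n (X (k + m) a)
      (leftSites (fun j => X j a) (k + m)) ∂(P y) = (1 - escapeProb ω n) * (P y).real B := by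
    intro m
    induction m with
    | zero =>
      rw [setIntegral_congr_ae (g := fun _ => 1 - escapeProb ω n) hB' ?_]
      · simp [mul_comm]
      · filter_upwards [hX.ae_isNearestNeighbor y, hX.start y] with a h₁ h₂ _
        have h₃ : n ∉ leftSites (fun j => X j a) k := fun h => by
          have := h₁.le_of_mem_leftSites h
          simp only [h₂] at this
          omega
        have h₄ := h₁.le_add k
        simp only [h₂] at h₄
        rw [add_zero, leftJumpLim, if_neg h₃, if_neg (by omega)]
    | succ m ih =>
      rw [← ih, ← add_assoc, hX.setIntegral_succ y (k + m) hbd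
        (hX.filtration.mono (Nat.le_add_right k m) _ hB)]
      refine setIntegral_congr_ae hB' ?_
      filter_upwards [hX.ae_isNearestNeighbor y] with a h₁ _
      exact (leftJumpLim_eq_stepAvg hω (h₁.good (k + m))).symm
  have hmeas : ∀ m, MeasurableSet {a | n ∈ leftSites (fun j => X j a) m} := fun m =>
    hX.filtration.le m _ (hX.measurableSet_of_congr m (fun h => n ∈ leftSites h m)
      fun h h' e => by rw [leftSites_congr e])
  have hfin : ∀ m : ℕ, (P y).real ({a | n ∈ leftSites (fun j => X j a) (k + m)} ∩ B) ≤
      (1 - escapeProb ω n) * (P y).real B := by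
    intro m
    rw [← hstep m, Set.inter_comm]
    have hint := (hX.integrable_state y (k + m) hbd).integrableOn (s := B)
    calc (P y).real (B ∩ {a | n ∈ leftSites (fun j => X j a) (k + m)})
        = ∫ a in B, {a | n ∈ leftSites (fun j => X j a) (k + m)}.indicator
            (fun _ => (1 : ℝ)) a ∂(P y) := by
          rw [setIntegral_indicator (hmeas _)]; simp
      _ ≤ _ := by
          refine setIntegral_mono ((integrable_const 1).indicator (hmeas _)).integrableOn hint
            fun a => ?_
          by_cases ha : n ∈ leftSites (fun j => X j a) (k + m)
          · rw [Set.indicator_of_mem (by exact ha), leftJumpLim, if_pos ha]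
          · rw [Set.indicator_of_notMem (by exact ha)]
            exact (leftJumpLim_mem_Icc hω _ _ _).1
  have hmono : Monotone fun m : ℕ => {a | n ∈ leftSites (fun j => X j a) (k + m)} ∩ B := by
    rintro m m' hm a ⟨⟨i, hi, h⟩, haB⟩
    exact ⟨⟨i, by omega, h⟩, haB⟩
  have hU : ⋃ m : ℕ, ({a | n ∈ leftSites (fun j => X j a) (k + m)} ∩ B) =
      {a | ∃ m, n ∈ leftSites (fun j => X j a) m} ∩ B := by
    rw [← Set.iUnion_inter]
    congr 1
    ext a
    simp only [Set.mem_iUnion, Set.mem_ofPred_eq]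
    exact ⟨fun ⟨m, h⟩ => ⟨_, h⟩, fun ⟨m, i, hi, h⟩ => ⟨m, i, by omega, h⟩⟩
  have h₂ := tendsto_measure_iUnion_atTop (μ := P y) hmono
  rw [hU] at h₂
  exact le_of_tendsto' ((ENNReal.tendsto_toReal (measure_ne_top (P y) _)).comp h₂) hfin

theorem IsCookieWalk.transient (hX : IsCookieWalk ω P X)
    (hω : ∀ x, ω x ∈ Set.Ico (1 / 2 : ℝ) 1) {N : ℕ} (hN1 : 1 ≤ N)
    (hN : ∀ x : ℤ, ω (x + N) = ω x) (hq : 0 < escapeProb ω 1) : Transient P X := by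
  intro x y
  have := hX.isProbabilityMeasure y
  have hle : ∀ k, hX.filtration k ≤ ⨆ n, hX.filtration n := le_iSup (fun n => hX.filtration n)
  refine measure_eq_zero_of_forall_inter_le hX.filtration (c := 1 - escapeProb ω 1) ?_
    (by linarith) fun k B hB => ?_
  · simp only [frequently_atTop, Set.ofPred_forall, Set.ofPred_exists]
    refine MeasurableSet.iInter fun K => MeasurableSet.iUnion fun k => ?_
    by_cases hk : K ≤ k
    · simp only [hk, true_and]
      exact hle k _ (hX.measurable_apply le_rfl (MeasurableSet.of_discrete (s := {x})))
    · simp [hk]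
  · obtain ⟨n, hn, hnx, e⟩ : ∃ n : ℤ, y + k < n ∧ x < n ∧ escapeProb ω n = escapeProb ω 1 := by
      have h : ((|x| + |y| + k).toNat : ℤ) * 1 ≤ (|x| + |y| + k).toNat * N :=
        mul_le_mul_of_nonneg_left (by omega) (by positivity)
      have h₁ := le_abs_self x
      have h₂ := le_abs_self y
      have h₃ := abs_nonneg x
      have h₄ := abs_nonneg y
      exact ⟨1 + (|x| + |y| + k).toNat * N, by omega, by omega,
        escapeProb_translate (periodic_mul hN _) 1⟩
    rw [← e]
    refine le_trans ?_ (hX.measureReal_inter_le hω y hn hB)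
    refine ENNReal.toReal_mono (measure_ne_top _ _) (measure_mono_ae ?_)
    filter_upwards [hX.ae_isNearestNeighbor y, hX.ae_exists_ge hω y] with a h₁ h₂
    rintro ⟨hfr, haB⟩
    obtain ⟨s, hs⟩ := h₂ n
    obtain ⟨t, hst, ht⟩ := (frequently_atTop.1 hfr) s
    obtain ⟨j, -, hj, hj'⟩ := h₁.exists_left_jump hst hs (by simp only [ht]; exact hnx)
    exact ⟨⟨j + 1, j, by omega, hj, hj'⟩, haB⟩

theorem IsCookieWalk.recurrent_iff_transient_iff (hX : IsCookieWalk ω P X)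
    (hω : ∀ x, ω x ∈ Set.Ico (1 / 2 : ℝ) 1) {N : ℕ} (hN1 : 1 ≤ N)
    (hN : ∀ x : ℤ, ω (x + N) = ω x) :
    (Recurrent P X ↔ (1 / (N : ℝ)) * ∑ x ∈ Finset.Icc (1 : ℤ) N, ω x / (1 - ω x) ≤ 2) ∧
    (Transient P X ↔ 2 < (1 / (N : ℝ)) * ∑ x ∈ Finset.Icc (1 : ℤ) N, ω x / (1 - ω x)) := by
  obtain ⟨h₁, h₂⟩ := escapeProb_dichotomy hω hN1 hN
  have hR := fun h => hX.recurrent hω (h₁ h)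
  have hT := fun h => hX.transient hω hN1 hN (h₂ h 1)
  refine ⟨⟨fun h => ?_, hR⟩, ⟨fun h => ?_, hT⟩⟩
  · by_contra! hlt
    exact (hT hlt).not_recurrent h
  · by_contra! hle
    exact h.not_recurrent (hR hle)

end CookieWalk

/-! ### The main theorem -/

theorem theorem1 {Ω : Type*} [MeasurableSpace Ω] (ω : ℤ → ℝ)
    (hω : ∀ x, ω x ∈ Set.Ico (1 / 2 : ℝ) 1) (P : ℤ → Measure Ω) (X : ℕ → Ω → ℤ)
    (hX : CookieWalk.IsCookieWalk ω P X) :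
    (∀ p : ℝ, p ∈ Set.Ioo (1 / 2 : ℝ) 1 → (∀ x, ω x = p) →
      (p ≤ 2 / 3 → (P 1).real {a | CookieWalk.hitTime X 0 a = ⊤} = 0) ∧
      (2 / 3 < p →
        (3 * p - 2) / p ≤ (P 1).real {a | CookieWalk.hitTime X 0 a = ⊤} ∧
        (P 1).real {a | CookieWalk.hitTime X 0 a = ⊤} ≤ (3 * p - 2) / (p * (2 * p - 1))) ∧
      (CookieWalk.Recurrent P X ↔ p ≤ 2 / 3) ∧
      (CookieWalk.Transient P X ↔ 2 / 3 < p)) ∧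
    (∀ N : ℕ, 1 ≤ N → (∀ x : ℤ, ω (x + N) = ω x) →
      (CookieWalk.Recurrent P X ↔
        (1 / (N : ℝ)) * ∑ x ∈ Finset.Icc (1 : ℤ) N, ω x / (1 - ω x) ≤ 2) ∧
      (CookieWalk.Transient P X ↔
        2 < (1 / (N : ℝ)) * ∑ x ∈ Finset.Icc (1 : ℤ) N, ω x / (1 - ω x))) := by
  refine ⟨fun p hp hωp => ?_, fun N hN1 hN => hX.recurrent_iff_transient_iff hω hN1 hN⟩
  have hN : ∀ x : ℤ, ω (x + (1 : ℕ)) = ω x := fun x => by rw [hωp, hωp]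
  have h₁ : 0 < 1 - p := by linarith [hp.2]
  have h₂ : 0 < 2 * p - 1 := by linarith [hp.1]
  have h₃ : 0 < p := by linarith [hp.1]
  have hmean : (1 / ((1 : ℕ) : ℝ)) * ∑ x ∈ Finset.Icc (1 : ℤ) (1 : ℕ), ω x / (1 - ω x) ≤ 2 ↔
      p ≤ 2 / 3 := by
    simp only [Nat.cast_one, Finset.Icc_self, Finset.sum_singleton, hωp]
    rw [div_one, one_mul, div_le_iff₀ h₁]
    constructor <;> intro h <;> linarith
  have hmain := hX.recurrent_iff_transient_iff hω le_rfl hN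
  rw [hmean, ← not_le, hmean, not_le] at hmain
  refine ⟨fun h => ?_, fun h => ?_, hmain⟩
  · rw [hX.measureReal_hitTime_eq_top hω]
    exact (CookieWalk.escapeProb_dichotomy hω le_rfl hN).1 (hmean.2 h) 1
  · rw [hX.measureReal_hitTime_eq_top hω, CookieWalk.escapeProb_of_const hp hωp h]
    have h₄ : 0 < 3 * p - 2 := by linarith
    -- Both bounds weaken the exact value `(3p - 2) / (2p - 1)`, since `p * (2p - 1) ≤ 2p - 1 ≤ p`.
    constructor
    · exact div_le_div_of_nonneg_left h₄.le h₂ (by linarith)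
    · exact div_le_div_of_nonneg_left h₄.le (mul_pos h₃ h₂) (mul_le_of_le_one_left h₂.le hp.2.le)
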